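/- For $0\le d<1$ and $\alpha>-d$ let $\mathrm{PY}(d,\alpha)$ be the law of the random weights $\pi=(\pi_1,\pi_2,\dots)$ given by stick-breaking, $\pi_i=\beta_i\prod_{j<i}(1-\beta_j)$ with independent $\beta_i\sim\mathrm{Beta}(1-d,\alpha+id)$, and let $H(\pi)=-\sum_i\pi_i\log\pi_i\in[0,\infty]$. Let $x=(x_1,\dots,x_N)$ be a fixed dataset with $K$ distinct symbols, and let $$p(x\mid\pi)=\sum_{\sigma}\prod_{j=1}^N \pi_{\sigma(x_j)}$$ be its likelihood, where $\sigma$ runs over the injections of the set of the $K$ observed symbols into $\{1,2,\dots\}$ (the symbols are attached to the weights through a non-atomic base measure, so that only the pattern of coincidences matters). Put $$p(x\mid d,\alpha)=\mathbb E_{\pi\sim \mathrm{PY}(d,\alpha)}\big[p(x\mid\pi)\big],\qquad \mathbb E[H\mid x,d,\alpha]=\frac{\mathbb E_{\pi\sim \mathrm{PY}(d,\alpha)}\big[H(\pi)\,p(x\mid\pi)\big]}{p(x\mid d,\alpha)} .$$ Let $P$ be a prior on the parameter set $\{(d,\alpha):0\le d<1,\ \alpha>-d\}$, that is, a nonzero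 measure that is the sum of a finite measure and of a measure with a bounded density with respect to Lebesgue measure; thus $P$ may be any probability distribution, or any bounded improper prior, such as the flat prior $p(d,\alpha)=1$ on $[0,1)\times(0,\infty)$. Put $$p(x)=\int p(x\mid d,\alpha)\,dP(d,\alpha),\qquad \hat H_{\mathrm{PYM}}=\int \mathbb E[H\mid x,d,\alpha]\,\frac{p(x\mid d,\alpha)}{p(x)}\,dP(d,\alpha).$$ If $N-K\ge 2$ (the data contain at least two coincidences), then $0<p(x)<\infty$ and $\hat H_{\mathrm{PYM}}<\infty$. -/

import Mathlib

open MeasureTheory ProbabilityTheory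
open scoped ENNReal NNReal

noncomputable section

/-- The stick-breaking map. With indices starting at `0`, the `i`-th weight is
`β i * ∏_{j < i} (1 - β j)`. -/
def stickBreaking (β : ℕ → ℝ) (i : ℕ) : ℝ :=
  β i * ∏ j ∈ Finset.range i, (1 - β j)

/-- The law `PY(d, α)` of the Pitman–Yor weights `π = (π₀, π₁, …)`: stick-breaking applied to
independent variables `β i ~ Beta(1 - d, α + (i + 1) d)` (the index `i` starts at `0`). -/
def pitmanYor (d α : ℝ) : Measure (ℕ → ℝ) :=
  (Measure.infinitePi fun i : ℕ => betaMeasure (1 - d) (α + ((i : ℝ) + 1) * d)).map stickBreaking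

/-- The admissible parameters `(d, α)` of a Pitman–Yor process: `0 ≤ d < 1` and `α > -d`. -/
def pyParams : Set (ℝ × ℝ) :=
  {p | 0 ≤ p.1 ∧ p.1 < 1 ∧ -p.1 < p.2}

/-- Shannon entropy `-∑ πᵢ log πᵢ` in nats, as an element of `[0, ∞]`. -/
def shannonEntropy (π : ℕ → ℝ) : ℝ≥0∞ :=
  ∑' i, ENNReal.ofReal (Real.negMulLog (π i))

/-- The number `K` of distinct symbols in the dataset `x`. -/
def numDistinct {N : ℕ} {X : Type*} (x : Fin N → X) : ℕ :=
  (Set.range x).ncard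

/-- The likelihood `p(x | π)` of the dataset `x` given the weights `π`. The atoms carrying the
weights are drawn from a non-atomic base measure, so they are almost surely distinct and which
symbol sits on which atom is not prescribed: the distinct observed symbols are assigned to distinct
atoms in all possible ways `σ`, and each assignment contributes the probability `∏ⱼ π_{σ(xⱼ)}` of
the corresponding i.i.d. draws. -/
def likelihood {N : ℕ} {X : Type*} (x : Fin N → X) (π : ℕ → ℝ) : ℝ≥0∞ :=
  ∑' σ : Set.range x ↪ ℕ, ∏ j : Fin N, ENNReal.ofReal (π (σ ⟨x j, Set.mem_range_self j⟩))

/-- The evidence `p(x | d, α) = ∫ p(x | π) p(π | d, α) dπ`. -/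
def evidence {N : ℕ} {X : Type*} (x : Fin N → X) (d α : ℝ) : ℝ≥0∞ :=
  ∫⁻ π, likelihood x π ∂(pitmanYor d α)

/-- The posterior mean `E[H | x, d, α]` of the entropy under a `PY(d, α)` prior (Bayes' rule). -/
def posteriorMean {N : ℕ} {X : Type*} (x : Fin N → X) (d α : ℝ) : ℝ≥0∞ :=
  (∫⁻ π, shannonEntropy π * likelihood x π ∂(pitmanYor d α)) / evidence x d α

/-- The marginal `p(x) = ∫ p(x | d, α) p(d, α) d(d, α)` under the mixing measure `P`. -/
def marginal {N : ℕ} {X : Type*} (P : Measure (ℝ × ℝ)) (x : Fin N → X) : ℝ≥0∞ :=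
  ∫⁻ p, evidence x p.1 p.2 ∂P

/-- The Pitman–Yor mixture estimate
`∫ E[H | x, d, α] * (p(x | d, α) / p(x)) p(d, α) d(d, α)`. -/
def pymEstimate {N : ℕ} {X : Type*} (P : Measure (ℝ × ℝ)) (x : Fin N → X) : ℝ≥0∞ :=
  ∫⁻ p, posteriorMean x p.1 p.2 * (evidence x p.1 p.2 / marginal P x) ∂P

/-- A prior on the Pitman–Yor parameters `(d, α)`: a nonzero measure carried by `pyParams` that is
the sum of a finite measure and of a measure with bounded density with respect to Lebesgue measure.
Every probability measure on `pyParams` is a prior (take `f = 0`), and so is every, possibly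
improper, bounded density (take `ν = 0`), in particular the flat one. -/
structure IsPYMPrior (P : Measure (ℝ × ℝ)) : Prop where
  ne_zero : P ≠ 0
  carried : P pyParamsᶜ = 0
  proper_add_bounded : ∃ (ν : Measure (ℝ × ℝ)) (f : ℝ × ℝ → ℝ≥0) (C : ℝ≥0),
    IsFiniteMeasure ν ∧ Measurable f ∧ (∀ p, f p ≤ C) ∧
      P = ν + volume.withDensity fun p => (f p : ℝ≥0∞)

end

/-! Both the evidence and the unnormalized posterior mean of the entropy are bounded by a constant
times `(α + 2) ^ (-3/2)`, uniformly in `d`. This function is integrable against finite measures and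
against bounded densities on the strip `0 ≤ d < 1`.

The bounds come from a closed formula for the mean of `∑ ∏ π (σ j) ^ a j` over injections `σ`, valid
for real exponents `a j > d` (`pyMoment`). Only the upper bound is needed. It follows by
conditioning on the first stick: the remaining weights are `1 - b` times those of `PY(d, α + d)`,
and at most one symbol sits on the first atom (`pyMoment_recursion`, `lintegral_injSum_le`).

The entropy fits this formula because `-t log t ≤ t ^ (1 - ε) / ε`: an atom outside the range of `σ`
acts as one extra symbol with exponent `1 - ε`, and an atom inside contributes at most `1`
(`shannonEntropy_mul_tsum_le`). The choice `ε = (1 - d) / 2` keeps `1 - ε > d`. The cost `1 / ε` is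
repaid by a factor `1 - d` supplied by any symbol seen twice. Two coincidences give decay `α ^
(-2)`, and the extra symbol loses a power `ε ≤ 1/2`, which leaves `-3/2`.

Positivity of the marginal needs only one assignment `σ`, whose mean is positive and continuous in
the parameters (`exists_stickMoment_le_evidence`). -/

noncomputable section

/-! ### Splitting off the first stick -/

/-- The sequence with first term `b` followed by the terms of `β`. -/
def seqCons (b : ℝ) (β : ℕ → ℝ) : ℕ → ℝ
  | 0 => b
  | i + 1 => β i

@[simp] lemma seqCons_zero (b : ℝ) (β : ℕ → ℝ) : seqCons b β 0 = b := rfl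

@[simp] lemma seqCons_succ (b : ℝ) (β : ℕ → ℝ) (i : ℕ) : seqCons b β (i + 1) = β i := rfl

lemma measurable_seqCons : Measurable fun p : ℝ × (ℕ → ℝ) => seqCons p.1 p.2 := by
  refine measurable_pi_iff.2 fun i => ?_
  cases i with
  | zero => exact measurable_fst
  | succ i => exact (measurable_pi_apply i).comp measurable_snd

/-- Infinite products are determined by finite boxes, and prepending a coordinate pulls a box back
to a rectangle whose first side is everything when index `0` is unconstrained. -/
lemma map_seqCons_prod_infinitePi (μ : ℕ → Measure ℝ) [∀ i, IsProbabilityMeasure (μ i)] :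
    ((μ 0).prod (Measure.infinitePi fun i => μ (i + 1))).map (fun p => seqCons p.1 p.2) =
      Measure.infinitePi μ := by
  refine Measure.eq_infinitePi μ fun s t ht => ?_
  have hs : MeasurableSet (Set.pi (s : Set ℕ) t) :=
    MeasurableSet.pi s.countable_toSet fun i _ => ht i
  rw [Measure.map_apply measurable_seqCons hs]
  set s' : Finset ℕ := s.preimage Nat.succ (Nat.succ_injective.injOn) with hs'
  set t' : ℕ → Set ℝ := fun i => t (i + 1) with ht'
  have hpre : (fun p : ℝ × (ℕ → ℝ) => seqCons p.1 p.2) ⁻¹' (Set.pi (s : Set ℕ) t) =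
      (if 0 ∈ s then t 0 else Set.univ) ×ˢ Set.pi (s' : Set ℕ) t' := by
    ext ⟨b, β⟩
    simp only [Set.mem_preimage, Set.mem_pi, Finset.mem_coe, Set.mem_prod]
    constructor
    · intro h
      refine ⟨?_, fun i hi => h (i + 1) (by simpa [hs'] using hi)⟩
      split_ifs with h0
      · exact h 0 h0
      · trivial
    · rintro ⟨h0, h1⟩ i hi
      cases i with
      | zero => simpa [hi] using h0
      | succ i => exact h1 i (by simpa [hs'] using hi)
  have hprod : ∏ i ∈ s, μ i (t i) =
      (if 0 ∈ s then μ 0 (t 0) else 1) * ∏ i ∈ s', μ (i + 1) (t (i + 1)) := by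
    have him : ∏ i ∈ s', μ (i + 1) (t (i + 1)) = ∏ i ∈ s.erase 0, μ i (t i) := by
      rw [← Finset.prod_image (s := s') (g := Nat.succ) (f := fun i => μ i (t i))
        (Nat.succ_injective.injOn)]
      congr 1
      ext i
      cases i with
      | zero => simp
      | succ i => simp [hs']
    rw [him]
    split_ifs with h0
    · rw [Finset.mul_prod_erase s (fun i => μ i (t i)) h0]
    · rw [Finset.erase_eq_of_notMem h0, one_mul]
  rw [hpre, Measure.prod_prod, Measure.infinitePi_pi _ (fun i _ => ht (i + 1)), hprod]
  split_ifs <;> simp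

/-- Integration against an infinite product of probability measures, one coordinate at a time. -/
lemma lintegral_infinitePi_succ (μ : ℕ → Measure ℝ) [∀ i, IsProbabilityMeasure (μ i)]
    {f : (ℕ → ℝ) → ℝ≥0∞} (hf : Measurable f) :
    ∫⁻ β, f β ∂(Measure.infinitePi μ) =
      ∫⁻ b, ∫⁻ β, f (seqCons b β) ∂(Measure.infinitePi fun i => μ (i + 1)) ∂(μ 0) := by
  rw [← map_seqCons_prod_infinitePi μ, lintegral_map hf measurable_seqCons]
  exact lintegral_prod _ (hf.comp measurable_seqCons).aemeasurable

lemma stickBreaking_seqCons_zero (b : ℝ) (β : ℕ → ℝ) : stickBreaking (seqCons b β) 0 = b := by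
  simp [stickBreaking]

lemma stickBreaking_seqCons_succ (b : ℝ) (β : ℕ → ℝ) (i : ℕ) :
    stickBreaking (seqCons b β) (i + 1) = (1 - b) * stickBreaking β i := by
  simp only [stickBreaking, Finset.prod_range_succ', seqCons_succ, seqCons_zero]
  ring

lemma measurable_stickBreaking : Measurable stickBreaking := by
  unfold stickBreaking
  fun_prop

lemma stickBreaking_mem_Icc {β : ℕ → ℝ} (h : ∀ i, β i ∈ Set.Ioo (0 : ℝ) 1) (i : ℕ) :
    stickBreaking β i ∈ Set.Icc (0 : ℝ) 1 := by
  have h0 : 0 ≤ ∏ j ∈ Finset.range i, (1 - β j) :=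
    Finset.prod_nonneg fun j _ => by linarith [(h j).2]
  have h1 : ∏ j ∈ Finset.range i, (1 - β j) ≤ 1 :=
    Finset.prod_le_one (fun j _ => by linarith [(h j).2]) fun j _ => by linarith [(h j).1]
  exact ⟨mul_nonneg (h i).1.le h0, mul_le_one₀ (h i).2.le h0 h1⟩

/-! ### Support and mixed moments of beta laws -/

lemma measurable_betaPDF (a b : ℝ) : Measurable (betaPDF a b) :=
  (measurable_betaPDFReal a b).ennreal_ofReal

lemma ae_mem_Ioo_betaMeasure (a b : ℝ) : ∀ᵐ x ∂(betaMeasure a b), x ∈ Set.Ioo (0 : ℝ) 1 := by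
  rw [betaMeasure, ae_withDensity_iff (measurable_betaPDF a b)]
  refine Filter.Eventually.of_forall fun x hx => ?_
  by_contra h
  apply hx
  rcases le_or_gt x 0 with h0 | h0
  · exact betaPDF_eq_zero_of_nonpos h0
  · exact betaPDF_eq_zero_of_one_le (not_lt.1 fun h1 => h ⟨h0, h1⟩)

/-- The mixed moments of a beta distribution. -/
lemma lintegral_betaMeasure_moment {a b p q : ℝ} (ha : 0 < a) (hb : 0 < b) (hp : 0 ≤ p)
    (hq : 0 ≤ q) :
    ∫⁻ x, ENNReal.ofReal x ^ p * ENNReal.ofReal (1 - x) ^ q ∂(betaMeasure a b) =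
      ENNReal.ofReal (beta (a + p) (b + q) / beta a b) := by
  have hB := beta_pos ha hb
  have hB' : 0 < beta (a + p) (b + q) := beta_pos (by linarith) (by linarith)
  have hpt : ∀ x : ℝ, (betaPDF a b * fun x => ENNReal.ofReal x ^ p * ENNReal.ofReal (1 - x) ^ q) x =
      ENNReal.ofReal (beta (a + p) (b + q) / beta a b) * betaPDF (a + p) (b + q) x := by
    intro x
    rw [Pi.mul_apply]
    rcases le_or_gt x 0 with h0 | h0
    · simp [betaPDF_eq_zero_of_nonpos h0]
    rcases le_or_gt 1 x with h1 | h1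
    · simp [betaPDF_eq_zero_of_one_le h1]
    have h1' : 0 < 1 - x := by linarith
    rw [betaPDF_of_pos_lt_one h0 h1, betaPDF_of_pos_lt_one h0 h1,
      ENNReal.ofReal_rpow_of_pos h0, ENNReal.ofReal_rpow_of_pos h1',
      ← ENNReal.ofReal_mul (by positivity), ← ENNReal.ofReal_mul (by positivity),
      ← ENNReal.ofReal_mul (by positivity)]
    congr 1
    rw [show a + p - 1 = (a - 1) + p by ring, show b + q - 1 = (b - 1) + q by ring,
      Real.rpow_add h0, Real.rpow_add h1']
    field_simp
  rw [betaMeasure, lintegral_withDensity_eq_lintegral_mul _ (measurable_betaPDF a b) (by fun_prop),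
    lintegral_congr hpt, lintegral_const_mul _ (measurable_betaPDF _ _),
    lintegral_betaPDF_eq_one (by linarith) (by linarith), mul_one]

/-! ### Sums over injections -/

/-- The sum of `∏ j ∈ S, w (σ j) ^ a j` over the injections `σ` of `S` into `{0, …, n - 1}`,
computed by deciding which element of `S`, if any, is sent to the first index. -/
def injSum {ι : Type*} [DecidableEq ι] (a : ι → ℝ) : ℕ → Finset ι → (ℕ → ℝ≥0∞) → ℝ≥0∞
  | 0, S, _ => if S = ∅ then 1 else 0
  | n + 1, S, w => injSum a n S (fun i => w (i + 1)) +
      ∑ j ∈ S, w 0 ^ a j * injSum a n (S.erase j) (fun i => w (i + 1))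

lemma sum_biUnion_le_sum_sum {ι κ : Type*} [DecidableEq ι] [DecidableEq κ] (S : Finset ι)
    (t : ι → Finset κ) (F : κ → ℝ≥0∞) :
    ∑ f ∈ S.biUnion t, F f ≤ ∑ j ∈ S, ∑ f ∈ t j, F f := by
  induction S using Finset.induction_on with
  | empty => simp
  | insert j S hj ih =>
    rw [Finset.biUnion_insert, Finset.sum_insert hj]
    exact (le_self_add.trans Finset.sum_union_inter.le).trans (by gcongr)

section injSum

variable {ι : Type*} [DecidableEq ι] {a : ι → ℝ}

lemma injSum_empty (n : ℕ) (w : ℕ → ℝ≥0∞) : injSum a n ∅ w = 1 := by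
  induction n generalizing w with
  | zero => simp [injSum]
  | succ n ih => simp [injSum, ih]

lemma monotone_injSum (S : Finset ι) (w : ℕ → ℝ≥0∞) : Monotone fun n => injSum a n S w := by
  refine monotone_nat_of_le_succ fun n => ?_
  induction n generalizing S w with
  | zero => exact le_self_add
  | succ n ih =>
    rw [injSum]
    conv_rhs => rw [injSum]
    gcongr
    · exact ih _ _
    · exact ih _ _

lemma measurable_injSum (n : ℕ) (S : Finset ι) : Measurable fun w => injSum a n S w := by
  induction n generalizing S with
  | zero => exact measurable_const
  | succ n ih =>
    have hshift : Measurable fun (w : ℕ → ℝ≥0∞) (i : ℕ) => w (i + 1) := by fun_prop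
    simp only [injSum]
    refine ((ih S).comp hshift).add (Finset.measurable_sum _ fun j _ => ?_)
    exact ((measurable_pi_apply 0).pow_const _).mul ((ih _).comp hshift)

/-- Homogeneity, to be used with `c = 1 - b`, the mass left after the first stick. -/
lemma injSum_mul_left (ha : ∀ j, 0 ≤ a j) (c : ℝ≥0∞) (n : ℕ) (S : Finset ι) (w : ℕ → ℝ≥0∞) :
    injSum a n S (fun i => c * w i) = c ^ (∑ j ∈ S, a j) * injSum a n S w := by
  induction n generalizing S w with
  | zero =>
    rcases eq_or_ne S ∅ with rfl | h
    · simp [injSum]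
    · simp [injSum, h]
  | succ n ih =>
    simp only [injSum]
    rw [ih, mul_add, Finset.mul_sum]
    congr 1
    refine Finset.sum_congr rfl fun j hj => ?_
    rw [ih, ENNReal.mul_rpow_of_nonneg _ _ (ha j), ← Finset.add_sum_erase S a hj,
      ENNReal.rpow_add_of_nonneg _ _ (ha j) (Finset.sum_nonneg fun i _ => ha i)]
    ring

/-- The injections of `S` into `{0, …, n - 1}`, as functions that vanish off `S`. -/
def injFinset [Fintype ι] (n : ℕ) (S : Finset ι) : Finset (ι → ℕ) :=
  (Fintype.piFinset fun j => if j ∈ S then Finset.range n else {0}).filter fun f => Set.InjOn f S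

/-- Shift by one the values on `S`. -/
def shiftOn (S : Finset ι) (f : ι → ℕ) : ι → ℕ := fun j => if j ∈ S then f j + 1 else 0

lemma mem_injFinset [Fintype ι] {n : ℕ} {S : Finset ι} {f : ι → ℕ} :
    f ∈ injFinset n S ↔ (∀ j ∈ S, f j < n) ∧ (∀ j ∉ S, f j = 0) ∧ Set.InjOn f S := by
  simp only [injFinset, Finset.mem_filter, Fintype.mem_piFinset, ← and_assoc]
  refine and_congr_left' ⟨fun h => ⟨fun j hj => ?_, fun j hj => ?_⟩, fun h j => ?_⟩
  · simpa [hj] using h j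
  · simpa [hj] using h j
  · by_cases hj : j ∈ S
    · simpa [hj] using h.1 j hj
    · simpa [hj] using h.2 j hj

/-- By injectivity at most one `j` takes the value `0`. The default value `0` off `S.erase j` is
then the value at `j`, so `shiftOn (S.erase j)` recovers `f` from its decrement. -/
lemma injFinset_succ_subset [Fintype ι] (n : ℕ) (S : Finset ι) :
    injFinset (n + 1) S ⊆ (injFinset n S).image (shiftOn S) ∪
      S.biUnion fun j => (injFinset n (S.erase j)).image (shiftOn (S.erase j)) := by
  intro f hf
  obtain ⟨hlt, hoff, hinj⟩ := mem_injFinset.1 hf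
  rw [Finset.mem_union]
  by_cases h : ∃ j ∈ S, f j = 0
  · obtain ⟨j, hj, hj0⟩ := h
    have hne : ∀ i ∈ S, i ≠ j → f i ≠ 0 := fun i hi hij h0 => hij (hinj hi hj (h0.trans hj0.symm))
    refine Or.inr (Finset.mem_biUnion.2 ⟨j, hj, Finset.mem_image.2 ⟨fun i => f i - 1, ?_, ?_⟩⟩)
    · refine mem_injFinset.2 ⟨fun i hi => ?_, fun i hi => ?_, fun i hi k hk hik => ?_⟩
      · have h1 := hlt i (Finset.mem_of_mem_erase hi)
        have h2 := hne i (Finset.mem_of_mem_erase hi) (Finset.ne_of_mem_erase hi)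
        omega
      · by_cases hij : i = j
        · simp [hij, hj0]
        · simp [hoff i fun hi' => hi (Finset.mem_erase.2 ⟨hij, hi'⟩)]
      · have hi := Finset.mem_erase.1 (Finset.mem_coe.1 hi)
        have hk := Finset.mem_erase.1 (Finset.mem_coe.1 hk)
        have h1 := hne i hi.2 hi.1
        have h2 := hne k hk.2 hk.1
        have h3 : f i - 1 = f k - 1 := hik
        exact hinj hi.2 hk.2 (by omega)
    · ext i
      rw [shiftOn]
      split_ifs with hi
      · have := hne i (Finset.mem_of_mem_erase hi) (Finset.ne_of_mem_erase hi)
        omega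
      · by_cases hij : i = j
        · rw [hij, hj0]
        · rw [hoff i fun hi' => hi (Finset.mem_erase.2 ⟨hij, hi'⟩)]
  · push Not at h
    refine Or.inl (Finset.mem_image.2 ⟨fun i => f i - 1, ?_, ?_⟩)
    · refine mem_injFinset.2 ⟨fun i hi => ?_, fun i hi => ?_, fun i hi k hk hik => ?_⟩
      · have h1 := hlt i hi
        have h2 := h i hi
        omega
      · simp [hoff i hi]
      · have h1 := h i hi
        have h2 := h k hk
        have h3 : f i - 1 = f k - 1 := hik
        exact hinj hi hk (by omega)
    · ext i
      rw [shiftOn]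
      split_ifs with hi
      · have := h i hi
        omega
      · rw [hoff i hi]

lemma sum_injFinset_le [Fintype ι] (n : ℕ) (S : Finset ι) (w : ℕ → ℝ≥0∞) :
    ∑ f ∈ injFinset n S, ∏ j ∈ S, w (f j) ^ a j ≤ injSum a n S w := by
  induction n generalizing S w with
  | zero =>
    rcases eq_or_ne S ∅ with rfl | h
    · have hcard : (injFinset 0 (∅ : Finset ι)).card ≤ 1 := by
        refine Finset.card_le_one.2 fun f hf g hg => funext fun j => ?_
        rw [(mem_injFinset.1 hf).2.1 j (by simp), (mem_injFinset.1 hg).2.1 j (by simp)]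
      simpa [injSum] using hcard
    · obtain ⟨j, hj⟩ := Finset.nonempty_iff_ne_empty.2 h
      have : injFinset 0 S = ∅ :=
        Finset.eq_empty_of_forall_notMem fun f hf => by simpa using (mem_injFinset.1 hf).1 j hj
      simp [this]
  | succ n ih =>
    have hsum_image : ∀ (T : Finset (ι → ℕ)) (g : (ι → ℕ) → ι → ℕ) (F : (ι → ℕ) → ℝ≥0∞),
        ∑ f ∈ T.image g, F f ≤ ∑ f ∈ T, F (g f) := fun T g F =>
      Finset.sum_image_le_of_nonneg fun _ _ => zero_le
    rw [injSum]
    refine (Finset.sum_le_sum_of_subset (injFinset_succ_subset n S)).trans ?_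
    refine (le_self_add.trans (Finset.sum_union_inter).le).trans ?_
    gcongr ?_ + ?_
    · refine (hsum_image _ _ _).trans (le_trans (le_of_eq ?_) (ih S fun i => w (i + 1)))
      refine Finset.sum_congr rfl fun f _ => Finset.prod_congr rfl fun j hj => ?_
      simp [shiftOn, hj]
    · refine (sum_biUnion_le_sum_sum _ _ _).trans (Finset.sum_le_sum fun j hj => ?_)
      refine (hsum_image _ _ _).trans ?_
      refine le_trans (le_of_eq ?_)
        (mul_le_mul_right (ih (S.erase j) fun i => w (i + 1)) (w 0 ^ a j))
      rw [Finset.mul_sum]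
      refine Finset.sum_congr rfl fun f _ => ?_
      rw [← Finset.mul_prod_erase S _ hj]
      congr 1
      · simp [shiftOn]
      · refine Finset.prod_congr rfl fun i hi => ?_
        simp only [shiftOn, hi, if_true]

/-- The sum over all injections into `ℕ` is controlled by the finite sums. -/
lemma tsum_embedding_le_iSup_injSum [Fintype ι] (w : ℕ → ℝ≥0∞) :
    ∑' σ : ι ↪ ℕ, ∏ j, w (σ j) ^ a j ≤ ⨆ n, injSum a n Finset.univ w := by
  rw [ENNReal.tsum_eq_iSup_sum]
  refine iSup_le fun F => ?_
  set n := F.sup fun σ => Finset.univ.sup fun j => σ j + 1 with hn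
  refine le_trans ?_ (le_iSup _ n)
  refine le_trans ?_ (sum_injFinset_le n Finset.univ w)
  have hinj : Set.InjOn (fun σ : ι ↪ ℕ => (σ : ι → ℕ)) F := fun σ _ τ _ h => DFunLike.coe_injective h
  rw [← Finset.sum_image (g := fun σ : ι ↪ ℕ => (σ : ι → ℕ))
    (f := fun f : ι → ℕ => ∏ j, w (f j) ^ a j) hinj]
  refine Finset.sum_le_sum_of_subset fun f hf => ?_
  obtain ⟨σ, hσ, rfl⟩ := Finset.mem_image.1 hf
  refine mem_injFinset.2 ⟨fun j _ => ?_, fun j hj => (hj (Finset.mem_univ j)).elim,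
    σ.injective.injOn⟩
  have h1 : σ j + 1 ≤ Finset.univ.sup fun j => σ j + 1 :=
    Finset.le_sup (f := fun j => σ j + 1) (Finset.mem_univ j)
  have h2 : (Finset.univ.sup fun j => σ j + 1) ≤ n :=
    Finset.le_sup (f := fun σ : ι ↪ ℕ => Finset.univ.sup fun j => σ j + 1) hσ
  exact Nat.lt_of_succ_le (h1.trans h2)

end injSum

/-! ### The Pitman–Yor stick law -/

/-- The law of the stick proportions of a Pitman–Yor process. -/
def pySticks (d α : ℝ) : Measure (ℕ → ℝ) :=
  Measure.infinitePi fun i : ℕ => betaMeasure (1 - d) (α + ((i : ℝ) + 1) * d)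

/-- The stick-breaking weights as extended nonnegative reals. -/
def pyWeights (β : ℕ → ℝ) (i : ℕ) : ℝ≥0∞ := ENNReal.ofReal (stickBreaking β i)

lemma add_mul_pos_of_mem_pyParams {d α : ℝ} (h : (d, α) ∈ pyParams) (i : ℕ) :
    0 < α + ((i : ℝ) + 1) * d := by
  have h0 : 0 ≤ d := h.1
  have h2 : -d < α := h.2.2
  have : 0 ≤ (i : ℝ) * d := by positivity
  linarith

lemma add_mem_pyParams {d α : ℝ} (h : (d, α) ∈ pyParams) : (d, α + d) ∈ pyParams := by
  have h0 : 0 ≤ d := h.1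
  have h2 : -d < α := h.2.2
  exact ⟨h0, h.2.1, show -d < α + d by linarith⟩

lemma isProbabilityMeasure_betaMeasure_of_mem_pyParams {d α : ℝ} (h : (d, α) ∈ pyParams) (i : ℕ) :
    IsProbabilityMeasure (betaMeasure (1 - d) (α + ((i : ℝ) + 1) * d)) :=
  isProbabilityMeasureBeta (sub_pos.2 h.2.1) (add_mul_pos_of_mem_pyParams h i)

lemma isProbabilityMeasure_pySticks {d α : ℝ} (h : (d, α) ∈ pyParams) :
    IsProbabilityMeasure (pySticks d α) := by
  have := isProbabilityMeasure_betaMeasure_of_mem_pyParams h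
  unfold pySticks
  infer_instance

/-- Self-similarity: dropping the first stick replaces `α` by `α + d`. Every induction on the number
of atoms therefore generalizes over `α`. -/
lemma lintegral_pySticks_succ {d α : ℝ} (h : (d, α) ∈ pyParams) {f : (ℕ → ℝ) → ℝ≥0∞}
    (hf : Measurable f) :
    ∫⁻ β, f β ∂(pySticks d α) =
      ∫⁻ b, ∫⁻ β, f (seqCons b β) ∂(pySticks d (α + d)) ∂(betaMeasure (1 - d) (α + d)) := by
  have := isProbabilityMeasure_betaMeasure_of_mem_pyParams h
  have hshift : (Measure.infinitePi fun i : ℕ =>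
      betaMeasure (1 - d) (α + (((i + 1 : ℕ) : ℝ) + 1) * d)) = pySticks d (α + d) := by
    unfold pySticks
    congr 1
    ext1 i
    congr 1
    push_cast
    ring
  rw [pySticks, lintegral_infinitePi_succ _ hf, hshift]
  simp

lemma ae_pySticks_mem_Ioo {d α : ℝ} (h : (d, α) ∈ pyParams) :
    ∀ᵐ β ∂(pySticks d α), ∀ i, β i ∈ Set.Ioo (0 : ℝ) 1 := by
  have := isProbabilityMeasure_betaMeasure_of_mem_pyParams h
  refine ae_all_iff.2 fun i => ?_
  exact (measurePreserving_eval_infinitePi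
    (fun i : ℕ => betaMeasure (1 - d) (α + ((i : ℝ) + 1) * d)) i).quasiMeasurePreserving.ae
    (ae_mem_Ioo_betaMeasure _ _)

lemma measurable_pyWeights : Measurable pyWeights :=
  measurable_pi_iff.2 fun i =>
    ((measurable_pi_apply i).comp measurable_stickBreaking).ennreal_ofReal

lemma pyWeights_seqCons_succ {b : ℝ} (hb : b ≤ 1) (β : ℕ → ℝ) :
    (fun i => pyWeights (seqCons b β) (i + 1)) =
      fun i => ENNReal.ofReal (1 - b) * pyWeights β i := by
  ext1 i
  rw [pyWeights, stickBreaking_seqCons_succ, ENNReal.ofReal_mul (sub_nonneg.2 hb), pyWeights]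

lemma add_sum_pos_of_mem_pyParams {ι : Type*} {d α : ℝ} {a : ι → ℝ}
    (h : (d, α) ∈ pyParams) (ha : ∀ j, d < a j) {S : Finset ι} (hS : S.Nonempty) :
    0 < α + ∑ j ∈ S, a j := by
  obtain ⟨j, hj⟩ := hS
  have h0 : 0 ≤ d := h.1
  have h2 : -d < α := h.2.2
  have h1 : a j ≤ ∑ j ∈ S, a j :=
    Finset.single_le_sum (fun i _ => h0.trans (ha i).le) hj
  linarith [ha j]

/-! ### Closed-form moments with real exponents -/

section pyMoment

variable {ι : Type*} [DecidableEq ι]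

/-- The mean of `∑ ∏ j ∈ S, π (σ j) ^ a j`, summed over the injections `σ : S → ℕ`, under
`PY(d, α)`. -/
def pyMoment (d α : ℝ) (a : ι → ℝ) (S : Finset ι) : ℝ :=
  if S = ∅ then 1 else
    (∏ i ∈ Finset.range (S.card - 1), (α + ((i : ℝ) + 1) * d)) *
      (Real.Gamma (1 + α) / Real.Gamma (α + ∑ j ∈ S, a j)) *
      ∏ j ∈ S, (Real.Gamma (a j - d) / Real.Gamma (1 - d))

/-- For `α > 0` the missing factor `α` is absorbed by `Γ(1 + α) = α Γ(α)`. The definition avoids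
`Γ(α)` because `α ≤ 0` is admissible; this form serves for the shifted parameter `α + d > 0`. -/
lemma pyMoment_of_pos {d α : ℝ} (hα : 0 < α) (a : ι → ℝ) (S : Finset ι) :
    pyMoment d α a S = (∏ i ∈ Finset.range S.card, (α + (i : ℝ) * d)) *
      (Real.Gamma α / Real.Gamma (α + ∑ j ∈ S, a j)) *
      ∏ j ∈ S, (Real.Gamma (a j - d) / Real.Gamma (1 - d)) := by
  have hΓ := (Real.Gamma_pos_of_pos hα).ne'
  rw [pyMoment]
  split_ifs with h
  · simp [h, hΓ]
  · have hc : S.card = (S.card - 1) + 1 := by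
      have := Finset.card_pos.2 (Finset.nonempty_iff_ne_empty.2 h)
      omega
    conv_rhs => rw [hc, Finset.prod_range_succ']
    rw [add_comm 1 α, Real.Gamma_add_one hα.ne']
    push_cast
    ring

variable {d α : ℝ} {a : ι → ℝ}

lemma pyMoment_nonneg (h : (d, α) ∈ pyParams) (ha : ∀ j, d < a j) (S : Finset ι) :
    0 ≤ pyMoment d α a S := by
  rw [pyMoment]
  split_ifs with hS
  · exact zero_le_one
  have h1 : d < 1 := h.2.1
  have h2 : -d < α := h.2.2
  refine mul_nonneg (mul_nonneg (Finset.prod_nonneg fun i _ =>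
    (add_mul_pos_of_mem_pyParams h i).le) (div_nonneg ?_ ?_))
    (Finset.prod_nonneg fun j _ => div_nonneg ?_ ?_)
  · exact (Real.Gamma_pos_of_pos (by linarith)).le
  · exact (Real.Gamma_pos_of_pos
      (add_sum_pos_of_mem_pyParams h ha (Finset.nonempty_iff_ne_empty.2 hS))).le
  · exact (Real.Gamma_pos_of_pos (by linarith [ha j])).le
  · exact (Real.Gamma_pos_of_pos (by linarith)).le

/-- The share of the moment carried by assignments that leave the first atom empty. -/
lemma beta_ratio_mul_pyMoment (h : (d, α) ∈ pyParams) (ha : ∀ j, d < a j) {S : Finset ι}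
    (hS : S.Nonempty) :
    beta (1 - d) (α + d + ∑ j ∈ S, a j) / beta (1 - d) (α + d) * pyMoment d (α + d) a S =
      pyMoment d α a S * ((α + S.card * d) / (α + ∑ j ∈ S, a j)) := by
  have h0 : 0 ≤ d := h.1
  have h1 : d < 1 := h.2.1
  have h2 : -d < α := h.2.2
  have hA := add_sum_pos_of_mem_pyParams h ha hS
  obtain ⟨m, hm⟩ : ∃ m, S.card = m + 1 := ⟨S.card - 1, by have := Finset.card_pos.2 hS; omega⟩
  rw [pyMoment_of_pos (by linarith), pyMoment, if_neg hS.ne_empty, hm, beta, beta]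
  have hprod : ∏ i ∈ Finset.range (m + 1), (α + d + (i : ℝ) * d) =
      (∏ i ∈ Finset.range m, (α + ((i : ℝ) + 1) * d)) * (α + ((m : ℝ) + 1) * d) := by
    rw [Finset.prod_range_succ]
    congr 1
    · exact Finset.prod_congr rfl fun i _ => by ring
    · ring
  set A := ∑ j ∈ S, a j
  have e1 : 1 - d + (α + d + A) = α + A + 1 := by ring
  have e2 : 1 - d + (α + d) = 1 + α := by ring
  have g1 := (Real.Gamma_pos_of_pos (show 0 < 1 - d by linarith)).ne'
  have g2 := (Real.Gamma_pos_of_pos (show 0 < α + d by linarith)).ne'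
  have g3 := (Real.Gamma_pos_of_pos (show 0 < 1 + α by linarith)).ne'
  have g4 := (Real.Gamma_pos_of_pos hA).ne'
  have g5 := (Real.Gamma_pos_of_pos (show 0 < α + d + A by linarith)).ne'
  rw [hprod, e1, e2, Real.Gamma_add_one hA.ne']
  push_cast
  generalize (∏ j ∈ S, Real.Gamma (a j - d) / Real.Gamma (1 - d)) = Q
  generalize (∏ i ∈ Finset.range m, (α + ((i : ℝ) + 1) * d)) = R
  field_simp

/-- The share carried by assignments that put `j` on the first atom. -/
lemma beta_ratio_mul_pyMoment_erase (h : (d, α) ∈ pyParams) (ha : ∀ j, d < a j) {S : Finset ι}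
    {j : ι} (hj : j ∈ S) :
    beta (1 - d + a j) (α + d + ∑ i ∈ S.erase j, a i) / beta (1 - d) (α + d) *
        pyMoment d (α + d) a (S.erase j) =
      pyMoment d α a S * ((a j - d) / (α + ∑ j ∈ S, a j)) := by
  have h0 : 0 ≤ d := h.1
  have h1 : d < 1 := h.2.1
  have h2 : -d < α := h.2.2
  have hS : S.Nonempty := ⟨j, hj⟩
  have hA := add_sum_pos_of_mem_pyParams h ha hS
  have hA' : 0 ≤ ∑ i ∈ S.erase j, a i := Finset.sum_nonneg fun i _ => h0.trans (ha i).le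
  rw [pyMoment_of_pos (by linarith), pyMoment, if_neg hS.ne_empty, Finset.card_erase_of_mem hj,
    beta, beta]
  have hprod : ∏ i ∈ Finset.range (S.card - 1), (α + d + (i : ℝ) * d) =
      ∏ i ∈ Finset.range (S.card - 1), (α + ((i : ℝ) + 1) * d) :=
    Finset.prod_congr rfl fun i _ => by ring
  have g1 := (Real.Gamma_pos_of_pos (show 0 < 1 - d by linarith)).ne'
  have g2 := (Real.Gamma_pos_of_pos (show 0 < α + d by linarith)).ne'
  have g3 := (Real.Gamma_pos_of_pos (show 0 < 1 + α by linarith)).ne'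
  have g4 := (Real.Gamma_pos_of_pos hA).ne'
  have g5 := (Real.Gamma_pos_of_pos (show 0 < α + d + ∑ i ∈ S.erase j, a i by linarith)).ne'
  rw [hprod, ← Finset.mul_prod_erase S (fun j => Real.Gamma (a j - d) / Real.Gamma (1 - d)) hj]
  have e1 : 1 - d + a j + (α + d + ∑ i ∈ S.erase j, a i) = α + ∑ i ∈ S, a i + 1 := by
    rw [← Finset.add_sum_erase S a hj]
    ring
  have e2 : 1 - d + (α + d) = 1 + α := by ring
  have e3 : 1 - d + a j = a j - d + 1 := by ring
  rw [e1, e2, e3, Real.Gamma_add_one hA.ne', Real.Gamma_add_one (by linarith [ha j])]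
  generalize (∏ j ∈ S.erase j, Real.Gamma (a j - d) / Real.Gamma (1 - d)) = Q
  generalize (∏ i ∈ Finset.range (S.card - 1), (α + ((i : ℝ) + 1) * d)) = R
  field_simp

/-- The shares `(α + |S| d) / (α + ∑ a)` and `(a j - d) / (α + ∑ a)` add up to one. -/
lemma pyMoment_recursion (h : (d, α) ∈ pyParams) (ha : ∀ j, d < a j) {S : Finset ι}
    (hS : S.Nonempty) :
    beta (1 - d) (α + d + ∑ j ∈ S, a j) / beta (1 - d) (α + d) * pyMoment d (α + d) a S +
      ∑ j ∈ S, beta (1 - d + a j) (α + d + ∑ i ∈ S.erase j, a i) / beta (1 - d) (α + d) *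
        pyMoment d (α + d) a (S.erase j) = pyMoment d α a S := by
  have hA := add_sum_pos_of_mem_pyParams h ha hS
  rw [beta_ratio_mul_pyMoment h ha hS,
    Finset.sum_congr rfl fun j hj => beta_ratio_mul_pyMoment_erase h ha hj,
    ← Finset.mul_sum, ← mul_add, ← Finset.sum_div, ← add_div, Finset.sum_sub_distrib,
    Finset.sum_const, nsmul_eq_mul]
  rw [show α + S.card * d + (∑ j ∈ S, a j - S.card * d) = α + ∑ j ∈ S, a j by ring,
    div_self hA.ne', mul_one]

/-- Conditioning on the first stick turns the recursion for `injSum` into `pyMoment_recursion`. The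
inequality enters at `n = 0`, where a nonempty `S` has no injections. -/
lemma lintegral_injSum_le (h : (d, α) ∈ pyParams) (ha : ∀ j, d < a j) (n : ℕ) (S : Finset ι) :
    ∫⁻ β, injSum a n S (pyWeights β) ∂(pySticks d α) ≤ ENNReal.ofReal (pyMoment d α a S) := by
  have hd0 : 0 ≤ d := h.1
  have hd1 : 0 < 1 - d := sub_pos.2 h.2.1
  have ha0 : ∀ j, 0 ≤ a j := fun j => hd0.trans (ha j).le
  induction n generalizing S α with
  | zero =>
    have := isProbabilityMeasure_pySticks h
    rcases eq_or_ne S ∅ with rfl | hS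
    · simp [injSum, pyMoment]
    · simp [injSum, hS]
  | succ n ih =>
    rcases S.eq_empty_or_nonempty with rfl | hS
    · have := isProbabilityMeasure_pySticks h
      simp [injSum_empty, pyMoment]
    have hα : 0 < α + d := by linarith [show -d < α from h.2.2]
    have h' := add_mem_pyParams h
    have hmeas : ∀ (n : ℕ) (T : Finset ι), Measurable fun β => injSum a n T (pyWeights β) :=
      fun n T => (measurable_injSum n T).comp measurable_pyWeights
    rw [lintegral_pySticks_succ h (hmeas (n + 1) S)]
    have hinner : ∀ᵐ b ∂(betaMeasure (1 - d) (α + d)),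
        ∫⁻ β, injSum a (n + 1) S (pyWeights (seqCons b β)) ∂(pySticks d (α + d)) ≤
          -- The trivial power puts the empty-first-atom term in the shape of a mixed beta moment.
          ENNReal.ofReal b ^ (0 : ℝ) * ENNReal.ofReal (1 - b) ^ (∑ j ∈ S, a j) *
              ENNReal.ofReal (pyMoment d (α + d) a S) +
            ∑ j ∈ S, ENNReal.ofReal b ^ a j * ENNReal.ofReal (1 - b) ^ (∑ i ∈ S.erase j, a i) *
              ENNReal.ofReal (pyMoment d (α + d) a (S.erase j)) := by
      filter_upwards [ae_mem_Ioo_betaMeasure (1 - d) (α + d)] with b hb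
      have hb0 : ∀ β, pyWeights (seqCons b β) 0 = ENNReal.ofReal b := fun β => by
        rw [pyWeights, stickBreaking_seqCons_zero]
      simp only [injSum, pyWeights_seqCons_succ hb.2.le, injSum_mul_left ha0, hb0]
      rw [lintegral_add_left ((hmeas n S).const_mul _), lintegral_const_mul _ (hmeas n S),
        lintegral_finsetSum _ fun j _ => ((hmeas n _).const_mul _).const_mul _]
      simp only [ENNReal.rpow_zero, one_mul]
      gcongr with j hj
      · exact ih h' S
      · rw [lintegral_const_mul _ ((hmeas n _).const_mul _), lintegral_const_mul _ (hmeas n _),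
          ← mul_assoc]
        gcongr
        exact ih h' _
    refine (lintegral_mono_ae hinner).trans ?_
    have hsum0 : ∀ T : Finset ι, 0 ≤ ∑ j ∈ T, a j := fun T => Finset.sum_nonneg fun i _ => ha0 i
    have hbr : ∀ p q : ℝ, 0 ≤ p → 0 ≤ q →
        0 ≤ beta (1 - d + p) (α + d + q) / beta (1 - d) (α + d) := fun p q hp hq =>
      div_nonneg (beta_pos (by linarith) (by linarith)).le (beta_pos hd1 hα).le
    have hterm : ∀ j, ∫⁻ b, ENNReal.ofReal b ^ a j *
          ENNReal.ofReal (1 - b) ^ (∑ i ∈ S.erase j, a i) *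
          ENNReal.ofReal (pyMoment d (α + d) a (S.erase j)) ∂(betaMeasure (1 - d) (α + d)) =
        ENNReal.ofReal (beta (1 - d + a j) (α + d + ∑ i ∈ S.erase j, a i) /
          beta (1 - d) (α + d) * pyMoment d (α + d) a (S.erase j)) := fun j => by
      rw [lintegral_mul_const _ (by fun_prop),
        lintegral_betaMeasure_moment hd1 hα (ha0 j) (hsum0 (S.erase j)),
        ← ENNReal.ofReal_mul (hbr _ _ (ha0 j) (hsum0 _))]
    rw [lintegral_add_left (by fun_prop), lintegral_mul_const _ (by fun_prop),
      lintegral_betaMeasure_moment hd1 hα le_rfl (hsum0 S),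
      lintegral_finsetSum _ fun j _ => by fun_prop,
      Finset.sum_congr rfl fun j _ => hterm j,
      ← ENNReal.ofReal_mul (hbr _ _ le_rfl (hsum0 _)),
      ← ENNReal.ofReal_sum_of_nonneg fun j _ => mul_nonneg (hbr _ _ (ha0 j) (hsum0 _))
        (pyMoment_nonneg h' ha _),
      ← ENNReal.ofReal_add (mul_nonneg (hbr _ _ le_rfl (hsum0 _)) (pyMoment_nonneg h' ha _))
        (Finset.sum_nonneg fun j _ => mul_nonneg (hbr _ _ (ha0 j) (hsum0 _))
          (pyMoment_nonneg h' ha _)), add_zero, pyMoment_recursion h ha hS]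

/-- The mean of the sum over injections, under the Pitman–Yor law. -/
lemma lintegral_iSup_injSum_le (h : (d, α) ∈ pyParams) (ha : ∀ j, d < a j) (S : Finset ι) :
    ∫⁻ β, ⨆ n, injSum a n S (pyWeights β) ∂(pySticks d α) ≤
      ENNReal.ofReal (pyMoment d α a S) := by
  have hmeas : ∀ n, Measurable fun β => injSum a n S (pyWeights β) :=
    fun n => (measurable_injSum n S).comp measurable_pyWeights
  rw [lintegral_iSup hmeas
    fun n m hnm β => monotone_injSum S (pyWeights β) hnm]
  exact iSup_le fun n => lintegral_injSum_le h ha n S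

end pyMoment

/-! ### The entropy as one extra symbol -/

lemma negMulLog_le_rpow_div {x ε : ℝ} (hx : 0 ≤ x) (hε : 0 < ε) (hε1 : ε < 1) :
    Real.negMulLog x ≤ x ^ (1 - ε) / ε := by
  rcases hx.eq_or_lt with rfl | hx
  · simp [Real.zero_rpow (sub_pos.2 hε1).ne']
  -- The bound `log y ≤ y ^ ε / ε` is taken at `y = 1 / x`.
  · have h := Real.log_le_rpow_div (inv_nonneg.2 hx.le) hε
    rw [Real.log_inv, Real.inv_rpow hx.le] at h
    have h2 := mul_le_mul_of_nonneg_left h hx.le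
    rw [Real.rpow_sub hx, Real.rpow_one]
    calc Real.negMulLog x = x * -Real.log x := by rw [Real.negMulLog]; ring
      _ ≤ x * ((x ^ ε)⁻¹ / ε) := h2
      _ = x / x ^ ε / ε := by ring

/-- Entropy times a sum over injections of `ι`, bounded by sums over injections of `ι` and of
`Option ι`. -/
lemma shannonEntropy_mul_tsum_le {ι : Type*} [Fintype ι] (a : ι → ℝ) {ε : ℝ} (hε : 0 < ε)
    (hε1 : ε < 1) {π : ℕ → ℝ} (hπ : ∀ i, π i ∈ Set.Icc (0 : ℝ) 1) :
    shannonEntropy π * ∑' σ : ι ↪ ℕ, ∏ j, ENNReal.ofReal (π (σ j)) ^ a j ≤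
      Fintype.card ι * ∑' σ : ι ↪ ℕ, ∏ j, ENNReal.ofReal (π (σ j)) ^ a j +
      ENNReal.ofReal (1 / ε) * ∑' σ : Option ι ↪ ℕ,
        ∏ j, ENNReal.ofReal (π (σ j)) ^ (j.elim (1 - ε) a : ℝ) := by
  set w : ℕ → ℝ≥0∞ := fun i => ENNReal.ofReal (π i) with hw
  set η : ℕ → ℝ≥0∞ := fun i => ENNReal.ofReal (Real.negMulLog (π i)) with hη
  have hη1 : ∀ i, η i ≤ 1 := fun i => by
    rw [← ENNReal.ofReal_one]
    exact ENNReal.ofReal_le_ofReal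
      ((Real.negMulLog_le_one_sub_self (hπ i).1).trans (by linarith [(hπ i).1]))
  have hηw : ∀ i, η i ≤ ENNReal.ofReal (1 / ε) * w i ^ (1 - ε) := fun i => by
    rw [hw, ENNReal.ofReal_rpow_of_nonneg (hπ i).1 (by linarith),
      ← ENNReal.ofReal_mul (by positivity)]
    exact ENNReal.ofReal_le_ofReal ((negMulLog_le_rpow_div (hπ i).1 hε hε1).trans_eq (by ring))
  -- An embedding of `Option ι` is an embedding `σ` of `ι` together with an atom outside its range,
  -- which matches the unoccupied part of the entropy.
  rw [← (Function.Embedding.optionEmbeddingEquiv ι ℕ).symm.tsum_eq, ENNReal.tsum_sigma',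
    ← ENNReal.tsum_mul_left, ← ENNReal.tsum_mul_left, ← ENNReal.tsum_mul_left, ← ENNReal.tsum_add]
  refine ENNReal.tsum_le_tsum fun σ => ?_
  have hsplit : shannonEntropy π = ∑' i : Set.range σ, η i + ∑' i : ↥(Set.range σ)ᶜ, η i :=
    (ENNReal.summable.tsum_add_tsum_compl ENNReal.summable).symm
  have hrange : ∑' i : Set.range σ, η i ≤ Fintype.card ι := by
    rw [tsum_range (f := η) σ.injective, tsum_fintype]
    refine (Finset.sum_le_sum fun j _ => hη1 (σ j)).trans ?_
    simp
  rw [hsplit, add_mul]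
  refine add_le_add (by gcongr) ?_
  rw [← ENNReal.tsum_mul_right, ← ENNReal.tsum_mul_left]
  refine ENNReal.tsum_le_tsum fun i => ?_
  rw [Fintype.prod_option, ← mul_assoc]
  gcongr ?_ * ?_
  · exact hηw i
  · simp

/-! ### Symbol counts and the likelihood -/

/-- The number of occurrences in the dataset `x` of an observed symbol. -/
def symbolCount {N : ℕ} {X : Type*} (x : Fin N → X) (y : Set.range x) : ℕ :=
  Nat.card {j // x j = y}

section symbolCount

variable {N : ℕ} {X : Type*} (x : Fin N → X)

lemma symbolCount_pos (y : Set.range x) : 0 < symbolCount x y := by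
  obtain ⟨_, j, rfl⟩ := y
  exact Nat.card_pos_iff.2 ⟨⟨⟨j, rfl⟩⟩, inferInstance⟩

lemma card_range_eq_numDistinct [Fintype (Set.range x)] :
    Fintype.card (Set.range x) = numDistinct x := by
  rw [numDistinct, ← Nat.card_eq_fintype_card, Nat.card_coe_set_eq]

lemma sum_symbolCount [Fintype (Set.range x)] : ∑ y, symbolCount x y = N := by
  classical
  have h := Finset.card_eq_sum_card_fiberwise (s := (Finset.univ : Finset (Fin N)))
    (t := (Finset.univ : Finset (Set.range x)))
    (f := fun j => (⟨x j, Set.mem_range_self j⟩ : Set.range x))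
    fun j _ => Finset.mem_coe.2 (Finset.mem_univ _)
  rw [Finset.card_univ, Fintype.card_fin] at h
  conv_rhs => rw [h]
  refine Finset.sum_congr rfl fun y _ => ?_
  rw [symbolCount, Nat.card_eq_fintype_card, Fintype.card_subtype]
  congr 1
  ext j
  simp [Subtype.ext_iff]

lemma likelihood_eq_tsum [Fintype (Set.range x)] (π : ℕ → ℝ) :
    likelihood x π = ∑' σ : Set.range x ↪ ℕ,
      ∏ y, ENNReal.ofReal (π (σ y)) ^ (symbolCount x y : ℝ) := by
  classical
  refine tsum_congr fun σ => ?_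
  rw [← Finset.prod_fiberwise (Finset.univ : Finset (Fin N))
    (fun j => (⟨x j, Set.mem_range_self j⟩ : Set.range x))]
  refine Finset.prod_congr rfl fun y _ => ?_
  rw [Finset.prod_congr rfl (g := fun _ => ENNReal.ofReal (π (σ y))) fun j hj => by
    rw [(Finset.mem_filter.1 hj).2], Finset.prod_const, ENNReal.rpow_natCast]
  congr 1
  rw [symbolCount, Nat.card_eq_fintype_card, Fintype.card_subtype]
  congr 1
  ext j
  simp [Subtype.ext_iff]

lemma exists_two_le_symbolCount [Fintype (Set.range x)] (hx : numDistinct x < N) :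
    ∃ y, 2 ≤ symbolCount x y := by
  by_contra! h
  have h1 : ∑ y, symbolCount x y ≤ ∑ _y : Set.range x, 1 :=
    Finset.sum_le_sum fun y _ => Nat.le_of_lt_succ (h y)
  rw [sum_symbolCount, Finset.sum_const, Finset.card_univ, card_range_eq_numDistinct] at h1
  simp at h1
  omega

end symbolCount

/-! ### Gamma function estimates -/

lemma Gamma_add_natCast {x : ℝ} (hx : 0 < x) (n : ℕ) :
    Real.Gamma (x + n) = Real.Gamma x * ∏ i ∈ Finset.range n, (x + i) := by
  induction n with
  | zero => simp
  | succ n ih =>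
    have : x + ((n + 1 : ℕ) : ℝ) = x + n + 1 := by push_cast; ring
    rw [this, Real.Gamma_add_one (by positivity), ih, Finset.prod_range_succ]
    ring

lemma prod_one_sub_add_le {d : ℝ} (h0 : 0 ≤ d) (h1 : d < 1) (n : ℕ) :
    ∏ i ∈ Finset.range n, (1 - d + i) ≤ n.factorial := by
  induction n with
  | zero => simp
  | succ n ih =>
    have hn : (0 : ℝ) ≤ n := by positivity
    rw [Finset.prod_range_succ, Nat.factorial_succ, mul_comm (n + 1)]
    push_cast
    exact mul_le_mul ih (by linarith) (by linarith) (by positivity)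

lemma Gamma_natCast_sub_div_nonneg {d : ℝ} (h1 : d < 1) {n : ℕ} (hn : 1 ≤ n) :
    0 ≤ Real.Gamma (n - d) / Real.Gamma (1 - d) := by
  have : (1 : ℝ) ≤ n := by exact_mod_cast hn
  exact div_nonneg (Real.Gamma_pos_of_pos (by linarith)).le
    (Real.Gamma_pos_of_pos (by linarith)).le

lemma Gamma_natCast_sub_div {d : ℝ} (h1 : d < 1) {n : ℕ} (hn : 1 ≤ n) :
    Real.Gamma (n - d) / Real.Gamma (1 - d) = ∏ i ∈ Finset.range (n - 1), (1 - d + i) := by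
  have hd : 0 < 1 - d := by linarith
  have : (n : ℝ) - d = 1 - d + ((n - 1 : ℕ) : ℝ) := by
    rw [Nat.cast_sub hn]; push_cast; ring
  rw [this, Gamma_add_natCast hd, mul_div_cancel_left₀ _ (Real.Gamma_pos_of_pos hd).ne']

lemma Gamma_natCast_sub_div_le {d : ℝ} (h0 : 0 ≤ d) (h1 : d < 1) {n : ℕ} (hn : 1 ≤ n) :
    Real.Gamma (n - d) / Real.Gamma (1 - d) ≤ n.factorial := by
  rw [Gamma_natCast_sub_div h1 hn]
  exact (prod_one_sub_add_le h0 h1 _).trans (by exact_mod_cast Nat.factorial_le (Nat.sub_le n 1))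

/-- A symbol seen twice keeps the first factor `1 - d` of the rising product. This zero at `d = 1`
cancels the singularities met later. -/
lemma Gamma_natCast_sub_div_le_of_two_le {d : ℝ} (h0 : 0 ≤ d) (h1 : d < 1) {n : ℕ} (hn : 2 ≤ n) :
    Real.Gamma (n - d) / Real.Gamma (1 - d) ≤ (1 - d) * n.factorial := by
  rw [Gamma_natCast_sub_div h1 (by omega), show n - 1 = (n - 2) + 1 by omega,
    Finset.prod_range_succ', mul_comm]
  simp only [Nat.cast_zero, add_zero]
  refine mul_le_mul_of_nonneg_left ?_ (by linarith)
  have hfac : ∏ i ∈ Finset.range (n - 2), (1 - d + ((i + 1 : ℕ) : ℝ)) ≤ (n - 1).factorial := by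
    rw [← Finset.prod_range_add_one_eq_factorial, show n - 1 = (n - 2) + 1 by omega,
      Finset.prod_range_succ']
    push_cast
    simp only [mul_one]
    refine Finset.prod_le_prod (fun i _ => ?_) fun i _ => by linarith
    have : (0 : ℝ) ≤ i := by positivity
    linarith
  exact hfac.trans (by exact_mod_cast Nat.factorial_le (Nat.sub_le n 1))

/-- Log-convexity of the Gamma function, in the form of a lower bound. -/
lemma Gamma_add_one_le_mul_rpow {y s : ℝ} (hy : 0 < y) (hs : 0 < s) (hs1 : s < 1) :
    Real.Gamma (y + 1) ≤ Real.Gamma (y + s) * (y + s) ^ (1 - s) := by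
  have hys : 0 < y + s := by linarith
  have hG := Real.Gamma_pos_of_pos hys
  have h := Real.Gamma_mul_add_mul_le_rpow_Gamma_mul_rpow_Gamma hys
    (show 0 < y + s + 1 by linarith) hs (show 0 < 1 - s by linarith) (by ring)
  rw [show s * (y + s) + (1 - s) * (y + s + 1) = y + 1 by ring, Real.Gamma_add_one hys.ne',
    Real.mul_rpow hys.le hG.le] at h
  calc _ ≤ _ := h
    _ = (Real.Gamma (y + s) ^ s * Real.Gamma (y + s) ^ (1 - s)) * (y + s) ^ (1 - s) := by ring
    _ = _ := by rw [← Real.rpow_add hG, show s + (1 - s) = 1 by ring, Real.rpow_one]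

/-- The ratio equals `2 Γ(t/2 + 1) / Γ(t + 1)`. Convexity and `Γ(1) = Γ(2) = 1` bound the
numerator's Gamma by `1`; log-convexity bounds the denominator below by `1/2`. -/
lemma Gamma_half_div_le {t : ℝ} (ht : 0 < t) (ht1 : t ≤ 1) :
    Real.Gamma (t / 2) / Real.Gamma t ≤ 4 := by
  have h1 : Real.Gamma (t / 2 + 1) ≤ 1 := by
    have h := Real.convexOn_Gamma.2 (show (1 : ℝ) ∈ Set.Ioi 0 by simp)
      (show (2 : ℝ) ∈ Set.Ioi 0 by simp) (show 0 ≤ 1 - t / 2 by linarith)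
      (show 0 ≤ t / 2 by linarith) (by ring)
    simp only [smul_eq_mul, Real.Gamma_one, Real.Gamma_two] at h
    rw [show (1 - t / 2) * 1 + t / 2 * 2 = t / 2 + 1 by ring] at h
    linarith
  have h2 : 1 / 2 ≤ Real.Gamma (t + 1) := by
    rcases ht1.eq_or_lt with rfl | ht1
    · rw [show (1 : ℝ) + 1 = 2 by norm_num, Real.Gamma_two]
      norm_num
    have h := Gamma_add_one_le_mul_rpow one_pos ht ht1
    rw [show (1 : ℝ) + 1 = 2 by norm_num, Real.Gamma_two, add_comm 1 t] at h
    have h3 : (t + 1) ^ (1 - t) ≤ 2 := by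
      calc (t + 1) ^ (1 - t) ≤ (t + 1) ^ (1 : ℝ) :=
            Real.rpow_le_rpow_of_exponent_le (by linarith) (by linarith)
        _ ≤ 2 := by rw [Real.rpow_one]; linarith
    have hG := Real.Gamma_pos_of_pos (show 0 < t + 1 by linarith)
    nlinarith
  rw [Real.Gamma_add_one (by positivity)] at h1 h2
  rw [div_le_iff₀ (Real.Gamma_pos_of_pos ht)]
  have h4 : t * Real.Gamma (t / 2) ≤ t * (4 * Real.Gamma t) := by linarith
  exact le_of_mul_le_mul_left h4 ht

/-- Factors are compared one by one through `d < 1`. Two surplus factors, one per coincidence, give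
the quadratic decay in `α`; any further ones are at least `1`. -/
lemma prod_mul_le_prod {d α : ℝ} (h : (d, α) ∈ pyParams) {k m : ℕ} (hkm : k + 2 ≤ m) :
    (∏ i ∈ Finset.range k, (α + ((i : ℝ) + 1) * d)) * ((α + k + 1) * (α + k + 2)) ≤
      ∏ i ∈ Finset.range m, (1 + α + i) := by
  have h0 : 0 ≤ d := h.1
  have h1 : d < 1 := h.2.1
  have h2 : -d < α := h.2.2
  have hpos : ∀ i : ℕ, 0 < 1 + α + (i : ℝ) := fun i => by
    have : (0 : ℝ) ≤ i := by positivity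
    linarith
  induction m, hkm using Nat.le_induction with
  | base =>
    rw [Finset.prod_range_succ, Finset.prod_range_succ, mul_assoc]
    have e1 : α + k + 1 = 1 + α + k := by ring
    have e2 : α + k + 2 = 1 + α + ((k + 1 : ℕ) : ℝ) := by push_cast; ring
    rw [e1, e2]
    refine mul_le_mul_of_nonneg_right ?_ (mul_pos (hpos _) (hpos _)).le
    refine Finset.prod_le_prod (fun i _ => (add_mul_pos_of_mem_pyParams h i).le) fun i _ => ?_
    have : ((i : ℝ) + 1) * d ≤ ((i : ℝ) + 1) * 1 := by gcongr
    linarith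
  | succ m hm ih =>
    rw [Finset.prod_range_succ]
    refine ih.trans (le_mul_of_one_le_right (Finset.prod_nonneg fun i _ => (hpos i).le) ?_)
    have : (1 : ℝ) ≤ m := by exact_mod_cast (by omega : 1 ≤ m)
    linarith

/-! ### Moment bounds uniform in the parameters -/

section bounds

variable {N : ℕ} {X : Type*} (x : Fin N → X)

lemma prod_Gamma_symbolCount_le [Fintype (Set.range x)] (hx : numDistinct x < N) {d : ℝ}
    (h0 : 0 ≤ d) (h1 : d < 1) :
    ∏ y, (Real.Gamma (symbolCount x y - d) / Real.Gamma (1 - d)) ≤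
      (1 - d) * ∏ y, ((symbolCount x y).factorial : ℝ) := by
  classical
  obtain ⟨z, hz⟩ := exists_two_le_symbolCount x hx
  rw [← Finset.mul_prod_erase _ _ (Finset.mem_univ z),
    ← Finset.mul_prod_erase _ (fun y => ((symbolCount x y).factorial : ℝ)) (Finset.mem_univ z),
    ← mul_assoc]
  refine mul_le_mul (Gamma_natCast_sub_div_le_of_two_le h0 h1 hz)
    (Finset.prod_le_prod (fun y _ => Gamma_natCast_sub_div_nonneg h1 (symbolCount_pos x y))
      fun y _ => Gamma_natCast_sub_div_le h0 h1 (symbolCount_pos x y))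
    (Finset.prod_nonneg fun y _ => Gamma_natCast_sub_div_nonneg h1 (symbolCount_pos x y)) ?_
  have : 0 ≤ 1 - d := by linarith
  positivity

variable {d α : ℝ}

lemma pyMoment_symbolCount_le [Fintype (Set.range x)] [DecidableEq (Set.range x)]
    (hx : numDistinct x + 2 ≤ N) (h : (d, α) ∈ pyParams) :
    pyMoment d α (fun y => (symbolCount x y : ℝ)) Finset.univ ≤
      2 * (∏ y, ((symbolCount x y).factorial : ℝ)) * (α + 2) ^ (-(3 / 2) : ℝ) := by
  have h0 : 0 ≤ d := h.1
  have h1 : d < 1 := h.2.1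
  have h2 : -d < α := h.2.2
  have hN : 0 < N := by omega
  have hne : (Finset.univ : Finset (Set.range x)) ≠ ∅ :=
    Finset.Nonempty.ne_empty ⟨⟨x ⟨0, hN⟩, Set.mem_range_self _⟩, Finset.mem_univ _⟩
  have hK : 0 < numDistinct x := by
    rw [← card_range_eq_numDistinct x]
    exact Finset.card_pos.2 (Finset.nonempty_iff_ne_empty.2 hne)
  have hQ := prod_Gamma_symbolCount_le x (by omega) h0 h1
  have hprod := prod_mul_le_prod h (k := numDistinct x - 1) (m := N - 1) (by omega)
  have hsum : ∑ y, (symbolCount x y : ℝ) = N := by exact_mod_cast sum_symbolCount x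
  have hG : Real.Gamma (α + N) =
      Real.Gamma (1 + α) * ∏ i ∈ Finset.range (N - 1), (1 + α + i) := by
    rw [← Gamma_add_natCast (by linarith), Nat.cast_sub hN]
    congr 1
    push_cast
    ring
  have hG1 := Real.Gamma_pos_of_pos (show 0 < 1 + α by linarith)
  have hR : 0 ≤ ∏ i ∈ Finset.range (numDistinct x - 1), (α + ((i : ℝ) + 1) * d) :=
    Finset.prod_nonneg fun i _ => (add_mul_pos_of_mem_pyParams h i).le
  have hD : 0 < ∏ i ∈ Finset.range (N - 1), (1 + α + (i : ℝ)) :=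
    Finset.prod_pos fun i _ => by
      have : (0 : ℝ) ≤ i := by positivity
      linarith
  have hF : 0 ≤ ∏ y, ((symbolCount x y).factorial : ℝ) := by positivity
  rw [pyMoment, if_neg hne, hsum, Finset.card_univ, card_range_eq_numDistinct, hG]
  have hk : (0 : ℝ) ≤ ((numDistinct x - 1 : ℕ) : ℝ) := by positivity
  generalize (∏ y, ((symbolCount x y).factorial : ℝ)) = F at *
  generalize (∏ y, (Real.Gamma (symbolCount x y - d) / Real.Gamma (1 - d))) = Q at *
  generalize (∏ i ∈ Finset.range (numDistinct x - 1), (α + ((i : ℝ) + 1) * d)) = R at *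
  generalize (∏ i ∈ Finset.range (N - 1), (1 + α + (i : ℝ))) = D at *
  generalize ((numDistinct x - 1 : ℕ) : ℝ) = k at *
  have hα1 : 0 < α + 1 := by linarith
  have hα2 : 0 < α + 2 := by linarith
  have hRD : R * (Real.Gamma (1 + α) / (Real.Gamma (1 + α) * D)) ≤ 1 / ((α + 1) * (α + 2)) := by
    rw [div_mul_eq_div_div, div_self hG1.ne', mul_one_div, div_le_div_iff₀ hD (by positivity),
      one_mul]
    refine le_trans ?_ hprod
    gcongr <;> linarith
  calc R * (Real.Gamma (1 + α) / (Real.Gamma (1 + α) * D)) * Q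
      ≤ R * (Real.Gamma (1 + α) / (Real.Gamma (1 + α) * D)) * ((1 - d) * F) := by gcongr
    _ ≤ 1 / ((α + 1) * (α + 2)) * ((1 - d) * F) := by
        refine mul_le_mul_of_nonneg_right hRD (mul_nonneg (by linarith) hF)
    _ = (1 - d) / ((α + 1) * (α + 2)) * F := by ring
    -- The pole at `α = -1` is approached only as `d → 1`, since `α > -d`; there `1 - d` cancels it.
    _ ≤ 2 / (α + 2) ^ 2 * F := by
        refine mul_le_mul_of_nonneg_right ?_ hF
        rw [div_le_div_iff₀ (by positivity) (by positivity)]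
        nlinarith [mul_pos hα1 hα2, mul_nonneg h0 hα1.le]
    _ = 2 * F * (α + 2) ^ (-2 : ℝ) := by
        rw [Real.rpow_neg hα2.le, Real.rpow_two]
        ring
    -- Decay is given away to share one rate with the entropy bound.
    _ ≤ 2 * F * (α + 2) ^ (-(3 / 2) : ℝ) := by
        gcongr
        · linarith
        · norm_num

/-- The constant is `8 N`: `1 / ε = 2 / (1 - d)` meets the factor `1 - d` of a repeated symbol,
`Γ(ε) / Γ(1 - d) ≤ 4`, and `N` comes from the fractional power lost to log-convexity. -/
lemma pyMoment_option_symbolCount_le [Fintype (Set.range x)] [DecidableEq (Option (Set.range x))]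
    (hx : numDistinct x + 2 ≤ N) (h : (d, α) ∈ pyParams) :
    1 / ((1 - d) / 2) * pyMoment d α
        (fun y : Option (Set.range x) => y.elim (1 - (1 - d) / 2) fun y => (symbolCount x y : ℝ))
        Finset.univ ≤
      8 * N * (∏ y, ((symbolCount x y).factorial : ℝ)) * (α + 2) ^ (-(3 / 2) : ℝ) := by
  have h0 : 0 ≤ d := h.1
  have h1 : d < 1 := h.2.1
  have h2 : -d < α := h.2.2
  have hN2 : (2 : ℝ) ≤ N := by exact_mod_cast (by omega : 2 ≤ N)
  have hQ := prod_Gamma_symbolCount_le x (by omega) h0 h1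
  have hQ0 : 0 ≤ ∏ y, (Real.Gamma (symbolCount x y - d) / Real.Gamma (1 - d)) :=
    Finset.prod_nonneg fun y _ => Gamma_natCast_sub_div_nonneg h1 (symbolCount_pos x y)
  have hprod := prod_mul_le_prod h (k := numDistinct x) (m := N) hx
  have hsum : ∑ y, (symbolCount x y : ℝ) = N := by exact_mod_cast sum_symbolCount x
  have hG : Real.Gamma (α + N + 1) = Real.Gamma (1 + α) * ∏ i ∈ Finset.range N, (1 + α + i) := by
    rw [← Gamma_add_natCast (by linarith)]
    congr 1
    ring
  have hG1 := Real.Gamma_pos_of_pos (show 0 < 1 + α by linarith)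
  have hR : 0 ≤ ∏ i ∈ Finset.range (numDistinct x), (α + ((i : ℝ) + 1) * d) :=
    Finset.prod_nonneg fun i _ => (add_mul_pos_of_mem_pyParams h i).le
  have hD : 0 < ∏ i ∈ Finset.range N, (1 + α + (i : ℝ)) :=
    Finset.prod_pos fun i _ => by
      have : (0 : ℝ) ≤ i := by positivity
      linarith
  have hF : 0 ≤ ∏ y, ((symbolCount x y).factorial : ℝ) := by positivity
  have hK : (1 : ℝ) ≤ (numDistinct x : ℝ) := by
    have : 0 < numDistinct x := by
      rw [← card_range_eq_numDistinct x]
      exact Fintype.card_pos_iff.2 ⟨⟨x ⟨0, by omega⟩, Set.mem_range_self _⟩⟩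
    exact_mod_cast this
  have hne : (Finset.univ : Finset (Option (Set.range x))) ≠ ∅ :=
    Finset.Nonempty.ne_empty ⟨none, Finset.mem_univ _⟩
  -- This trades the non-integer shift `N + 1 - ε` for `N + 1`, where Gamma is a rising product, at
  -- the cost of a power `ε ≤ 1/2`.
  have hlog := Gamma_add_one_le_mul_rpow (y := α + N) (s := 1 - (1 - d) / 2) (by linarith)
    (by linarith) (by linarith)
  have hhalf := Gamma_half_div_le (t := 1 - d) (by linarith) (by linarith)
  rw [pyMoment, if_neg hne, Fintype.sum_option, Fintype.prod_option, Finset.card_univ,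
    Fintype.card_option, card_range_eq_numDistinct, Nat.add_sub_cancel]
  simp only [Option.elim]
  rw [hsum, show 1 - (1 - d) / 2 - d = (1 - d) / 2 by ring,
    show α + (1 - (1 - d) / 2 + N) = α + N + (1 - (1 - d) / 2) by ring]
  rw [hG] at hlog
  generalize (∏ y, ((symbolCount x y).factorial : ℝ)) = F at *
  generalize (∏ y, (Real.Gamma (symbolCount x y - d) / Real.Gamma (1 - d))) = Q at *
  generalize (∏ i ∈ Finset.range (numDistinct x), (α + ((i : ℝ) + 1) * d)) = R at *
  generalize (∏ i ∈ Finset.range N, (1 + α + (i : ℝ))) = D at *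
  generalize (numDistinct x : ℝ) = k at *
  generalize (N : ℝ) = n at *
  have hα2 : 1 ≤ α + 2 := by linarith
  have hα0 : 0 < α + 2 := by linarith
  have hpow : (α + n + (1 - (1 - d) / 2)) ^ (1 - (1 - (1 - d) / 2)) ≤
      n * (α + 2) ^ (1 / 2 : ℝ) := by
    have hb : α + n + (1 - (1 - d) / 2) ≤ n * (α + 2) := by nlinarith
    have hb1 : 1 ≤ n * (α + 2) := by nlinarith
    calc (α + n + (1 - (1 - d) / 2)) ^ (1 - (1 - (1 - d) / 2))
        ≤ (n * (α + 2)) ^ (1 - (1 - (1 - d) / 2)) :=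
          Real.rpow_le_rpow (by linarith) hb (by linarith)
      _ ≤ (n * (α + 2)) ^ (1 / 2 : ℝ) :=
          Real.rpow_le_rpow_of_exponent_le hb1 (by linarith)
      _ = n ^ (1 / 2 : ℝ) * (α + 2) ^ (1 / 2 : ℝ) :=
          Real.mul_rpow (by linarith) (by linarith)
      _ ≤ n * (α + 2) ^ (1 / 2 : ℝ) := by
          gcongr
          calc n ^ (1 / 2 : ℝ) ≤ n ^ (1 : ℝ) :=
                Real.rpow_le_rpow_of_exponent_le (by linarith) (by norm_num)
            _ = n := Real.rpow_one n
  have hGs := Real.Gamma_pos_of_pos (show 0 < α + n + (1 - (1 - d) / 2) by linarith)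
  generalize Real.Gamma (α + n + (1 - (1 - d) / 2)) = Gs at *
  generalize (α + n + (1 - (1 - d) / 2)) ^ (1 - (1 - (1 - d) / 2)) = p at *
  have hratio : R * (Real.Gamma (1 + α) / Gs) ≤ p / (α + 2) ^ 2 := by
    rw [← mul_div_assoc, div_le_div_iff₀ hGs (by positivity)]
    have hsq : R * (α + 2) ^ 2 ≤ D := by
      refine le_trans ?_ hprod
      rw [sq]
      exact mul_le_mul_of_nonneg_left
        (mul_le_mul (by linarith) (by linarith) (by linarith) (by linarith)) hR
    calc R * Real.Gamma (1 + α) * (α + 2) ^ 2 = Real.Gamma (1 + α) * (R * (α + 2) ^ 2) := by ring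
      _ ≤ Real.Gamma (1 + α) * D := by gcongr
      _ ≤ Gs * p := hlog
      _ = p * Gs := mul_comm _ _
  have hp : p / (α + 2) ^ 2 ≤ n * (α + 2) ^ (-(3 / 2) : ℝ) := by
    have e : (α + 2) ^ (-(3 / 2) : ℝ) = (α + 2) ^ (1 / 2 : ℝ) / (α + 2) ^ 2 := by
      rw [← Real.rpow_two, ← Real.rpow_sub hα0]
      norm_num
    rw [e, ← mul_div_assoc]
    gcongr
  have hd : 0 < 1 - d := by linarith
  have hhalf0 : 0 ≤ Real.Gamma ((1 - d) / 2) / Real.Gamma (1 - d) :=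
    div_nonneg (Real.Gamma_pos_of_pos (by linarith)).le (Real.Gamma_pos_of_pos hd).le
  generalize Real.Gamma ((1 - d) / 2) / Real.Gamma (1 - d) = g at *
  have hp0 : 0 ≤ n * (α + 2) ^ (-(3 / 2) : ℝ) := by
    have : 0 ≤ n := by linarith
    positivity
  calc 1 / ((1 - d) / 2) * (R * (Real.Gamma (1 + α) / Gs) * (g * Q))
      ≤ 1 / ((1 - d) / 2) * (n * (α + 2) ^ (-(3 / 2) : ℝ) * (4 * ((1 - d) * F))) := by
        have : 0 ≤ (1 - d) / 2 := by linarith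
        refine mul_le_mul_of_nonneg_left ?_ (by positivity)
        exact mul_le_mul (hratio.trans hp)
          (mul_le_mul hhalf hQ hQ0 (by norm_num)) (mul_nonneg hhalf0 hQ0) hp0
    _ = 8 * n * F * (α + 2) ^ (-(3 / 2) : ℝ) := by
        field_simp
        ring

end bounds

/-- Uniform bounds over the admissible parameters, decaying as `α ^ (-3/2)`, for the evidence and
for the unnormalized posterior mean of the entropy. -/
theorem exists_evidence_entropy_bound {N : ℕ} {X : Type*} (x : Fin N → X)
    (hx : numDistinct x + 2 ≤ N) :
    ∃ C : ℝ, 0 ≤ C ∧ ∀ d α : ℝ, (d, α) ∈ pyParams →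
      evidence x d α ≤ ENNReal.ofReal (C * (α + 2) ^ (-(3 / 2) : ℝ)) ∧
      ∫⁻ π, shannonEntropy π * likelihood x π ∂(pitmanYor d α) ≤
        ENNReal.ofReal (C * (α + 2) ^ (-(3 / 2) : ℝ)) := by
  classical
  have : Fintype (Set.range x) := Fintype.ofFinite _
  set F : ℝ := ∏ y, ((symbolCount x y).factorial : ℝ) with hF
  have hF0 : 0 ≤ F := by positivity
  set K : ℝ := (Fintype.card (Set.range x) : ℝ) with hK
  refine ⟨(K + 1) * (2 * F) + 8 * N * F, by positivity, fun d α h => ?_⟩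
  have h0 : 0 ≤ d := h.1
  have h1 : d < 1 := h.2.1
  have h2 : -d < α := h.2.2
  have hr : 0 ≤ (α + 2) ^ (-(3 / 2) : ℝ) := Real.rpow_nonneg (by linarith) _
  generalize hrdef : (α + 2) ^ (-(3 / 2) : ℝ) = r at *
  set a : Set.range x → ℝ := fun y => (symbolCount x y : ℝ) with ha
  -- The extra exponent is `(1 + d) / 2`, the midpoint of `d` and `1`, so it exceeds `d`.
  set a' : Option (Set.range x) → ℝ := fun y => y.elim (1 - (1 - d) / 2) a with ha'
  have had : ∀ y, d < a y := fun y => by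
    have : (1 : ℝ) ≤ symbolCount x y := by exact_mod_cast symbolCount_pos x y
    exact h1.trans_le this
  have had' : ∀ y, d < a' y := fun y => by
    cases y with
    | none => simp only [ha', Option.elim]; linarith
    | some y => exact had y
  have hmeas : Measurable fun β => ⨆ n, injSum a n Finset.univ (pyWeights β) :=
    Measurable.iSup fun n => (measurable_injSum n _).comp measurable_pyWeights
  have hmeas' : Measurable fun β => ⨆ n, injSum a' n Finset.univ (pyWeights β) :=
    Measurable.iSup fun n => (measurable_injSum n _).comp measurable_pyWeights
  have hL : ∫⁻ β, ⨆ n, injSum a n Finset.univ (pyWeights β) ∂(pySticks d α) ≤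
      ENNReal.ofReal (2 * F * r) :=
    (lintegral_iSup_injSum_le h had _).trans (ENNReal.ofReal_le_ofReal
      ((pyMoment_symbolCount_le x hx h).trans_eq (by rw [hrdef])))
  have hLo : ENNReal.ofReal (1 / ((1 - d) / 2)) *
      ∫⁻ β, ⨆ n, injSum a' n Finset.univ (pyWeights β) ∂(pySticks d α) ≤
      ENNReal.ofReal (8 * N * F * r) := by
    refine (mul_le_mul_right (lintegral_iSup_injSum_le h had' _) _).trans ?_
    have hd : 0 < (1 - d) / 2 := by linarith
    rw [← ENNReal.ofReal_mul (by positivity)]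
    exact ENNReal.ofReal_le_ofReal ((pyMoment_option_symbolCount_le x hx h).trans_eq (by rw [hrdef]))
  constructor
  -- This direction of the change of variables needs no measurability of the likelihood.
  · refine (lintegral_map_le _ _).trans (le_trans (lintegral_mono fun β => ?_) (hL.trans ?_))
    · rw [likelihood_eq_tsum]
      exact tsum_embedding_le_iSup_injSum (pyWeights β)
    · refine ENNReal.ofReal_le_ofReal (mul_le_mul_of_nonneg_right ?_ hr)
      have : 0 ≤ K * (2 * F) + 8 * N * F := by positivity
      linarith
  · refine (lintegral_map_le _ _).trans ?_
    calc ∫⁻ β, shannonEntropy (stickBreaking β) * likelihood x (stickBreaking β) ∂(pySticks d α)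
        ≤ ∫⁻ β, (Fintype.card (Set.range x) * ⨆ n, injSum a n Finset.univ (pyWeights β)) +
            ENNReal.ofReal (1 / ((1 - d) / 2)) *
              ⨆ n, injSum a' n Finset.univ (pyWeights β) ∂(pySticks d α) := by
          refine lintegral_mono_ae ?_
          filter_upwards [ae_pySticks_mem_Ioo h] with β hβ
          rw [likelihood_eq_tsum]
          refine (shannonEntropy_mul_tsum_le a (ε := (1 - d) / 2) (by linarith) (by linarith)
            (stickBreaking_mem_Icc hβ)).trans ?_
          gcongr
          · exact tsum_embedding_le_iSup_injSum (pyWeights β)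
          · exact tsum_embedding_le_iSup_injSum (a := a') (pyWeights β)
      _ = Fintype.card (Set.range x) *
            ∫⁻ β, ⨆ n, injSum a n Finset.univ (pyWeights β) ∂(pySticks d α) +
          ENNReal.ofReal (1 / ((1 - d) / 2)) *
            ∫⁻ β, ⨆ n, injSum a' n Finset.univ (pyWeights β) ∂(pySticks d α) := by
          rw [lintegral_add_left (hmeas.const_mul _), lintegral_const_mul _ hmeas,
            lintegral_const_mul _ hmeas']
      _ ≤ ENNReal.ofReal K * ENNReal.ofReal (2 * F * r) + ENNReal.ofReal (8 * N * F * r) := by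
          rw [hK, ENNReal.ofReal_natCast]
          gcongr
      _ = ENNReal.ofReal ((K * (2 * F) + 8 * N * F) * r) := by
          rw [← ENNReal.ofReal_mul (by positivity), ← ENNReal.ofReal_add (by positivity)
            (by positivity)]
          congr 1
          ring
      _ ≤ _ := by
          refine ENNReal.ofReal_le_ofReal (mul_le_mul_of_nonneg_right ?_ hr)
          linarith

/-! ### Positivity of the marginal -/

/-- The mean of `∏ i < n, π i ^ c i` under `PY(d, α)`. -/
def stickMoment : ℕ → (ℕ → ℕ) → ℝ → ℝ → ℝ
  | 0, _, _, _ => 1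
  | n + 1, c, d, α =>
    beta (1 - d + c 0) (α + d + ((∑ i ∈ Finset.range n, c (i + 1) : ℕ) : ℝ)) /
      beta (1 - d) (α + d) * stickMoment n (fun i => c (i + 1)) d (α + d)

lemma stickMoment_pos (n : ℕ) (c : ℕ → ℕ) {d α : ℝ} (h : (d, α) ∈ pyParams) :
    0 < stickMoment n c d α := by
  induction n generalizing c α with
  | zero => exact one_pos
  | succ n ih =>
    have h1 : d < 1 := h.2.1
    have h2 : -d < α := h.2.2
    exact mul_pos (div_pos
      (beta_pos (add_pos_of_pos_of_nonneg (by linarith) (Nat.cast_nonneg _))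
        (add_pos_of_pos_of_nonneg (by linarith) (Nat.cast_nonneg _)))
      (beta_pos (by linarith) (by linarith))) (ih _ (add_mem_pyParams h))

lemma continuousOn_beta {S : Set (ℝ × ℝ)} {f g : ℝ × ℝ → ℝ} (hf : ContinuousOn f S)
    (hg : ContinuousOn g S) (hf0 : ∀ p ∈ S, 0 < f p) (hg0 : ∀ p ∈ S, 0 < g p) :
    ContinuousOn (fun p => beta (f p) (g p)) S := by
  have hΓ : ContinuousOn Real.Gamma (Set.Ioi 0) := fun s hs =>
    (Real.differentiableAt_Gamma fun m => by
      have h1 : (0 : ℝ) < s := hs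
      have h2 : (0 : ℝ) ≤ m := Nat.cast_nonneg m
      linarith).continuousAt.continuousWithinAt
  exact ((hΓ.comp hf hf0).mul (hΓ.comp hg hg0)).div
    (hΓ.comp (hf.add hg) fun p hp => add_pos (hf0 p hp) (hg0 p hp)) fun p hp =>
      (Real.Gamma_pos_of_pos (add_pos (hf0 p hp) (hg0 p hp))).ne'

/-- Continuity serves only to give the evidence a measurable positive minorant, so that
measurability of the evidence in `(d, α)` is never needed. -/
lemma continuousOn_stickMoment (n : ℕ) (c : ℕ → ℕ) :
    ContinuousOn (fun p : ℝ × ℝ => stickMoment n c p.1 p.2) pyParams := by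
  induction n generalizing c with
  | zero => exact continuousOn_const
  | succ n ih =>
    have hpos : ∀ p ∈ pyParams, 0 < 1 - p.1 ∧ 0 < p.2 + p.1 := fun p hp =>
      ⟨by linarith [hp.2.1], by linarith [hp.2.2]⟩
    refine ContinuousOn.mul (ContinuousOn.div ?_ ?_ fun p hp =>
      (beta_pos (hpos p hp).1 (hpos p hp).2).ne') ?_
    · exact continuousOn_beta (by fun_prop) (by fun_prop)
        (fun p hp => add_pos_of_pos_of_nonneg (hpos p hp).1 (Nat.cast_nonneg _))
        fun p hp => add_pos_of_pos_of_nonneg (hpos p hp).2 (Nat.cast_nonneg _)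
    · exact continuousOn_beta (by fun_prop) (by fun_prop) (fun p hp => (hpos p hp).1)
        fun p hp => (hpos p hp).2
    · exact (ih fun i => c (i + 1)).comp
        (f := fun p : ℝ × ℝ => (p.1, p.2 + p.1)) (by fun_prop) fun p hp => add_mem_pyParams hp

lemma lintegral_prod_pyWeights (n : ℕ) (c : ℕ → ℕ) {d α : ℝ} (h : (d, α) ∈ pyParams) :
    ∫⁻ β, ∏ i ∈ Finset.range n, pyWeights β i ^ c i ∂(pySticks d α) =
      ENNReal.ofReal (stickMoment n c d α) := by
  have hmeas : ∀ (n : ℕ) (c : ℕ → ℕ),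
      Measurable fun β => ∏ i ∈ Finset.range n, pyWeights β i ^ c i := fun n c =>
    Finset.measurable_prod _ fun i _ =>
      ((measurable_pi_apply i).comp measurable_pyWeights).pow_const _
  induction n generalizing c α with
  | zero =>
    have := isProbabilityMeasure_pySticks h
    simp [stickMoment]
  | succ n ih =>
    have hd1 : 0 < 1 - d := sub_pos.2 h.2.1
    have hα : 0 < α + d := by linarith [show -d < α from h.2.2]
    rw [lintegral_pySticks_succ h (hmeas _ _)]
    have hinner : ∀ᵐ b ∂(betaMeasure (1 - d) (α + d)),
        ∫⁻ β, ∏ i ∈ Finset.range (n + 1), pyWeights (seqCons b β) i ^ c i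
            ∂(pySticks d (α + d)) =
          ENNReal.ofReal b ^ (c 0 : ℝ) *
            ENNReal.ofReal (1 - b) ^ (((∑ i ∈ Finset.range n, c (i + 1) : ℕ) : ℝ)) *
            ENNReal.ofReal (stickMoment n (fun i => c (i + 1)) d (α + d)) := by
      filter_upwards [ae_mem_Ioo_betaMeasure (1 - d) (α + d)] with b hb
      rw [← ih (fun i => c (i + 1)) (add_mem_pyParams h), ← lintegral_const_mul _ (hmeas _ _)]
      refine lintegral_congr fun β => ?_
      have hsucc : ∀ i, pyWeights (seqCons b β) (i + 1) = ENNReal.ofReal (1 - b) * pyWeights β i :=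
        fun i => congrFun (pyWeights_seqCons_succ hb.2.le β) i
      have hzero : pyWeights (seqCons b β) 0 = ENNReal.ofReal b := by
        rw [pyWeights, stickBreaking_seqCons_zero]
      simp only [Finset.prod_range_succ', hsucc, hzero, mul_pow, Finset.prod_mul_distrib,
        Finset.prod_pow_eq_pow_sum, ENNReal.rpow_natCast]
      ring
    rw [lintegral_congr_ae hinner, lintegral_mul_const _ (by fun_prop),
      lintegral_betaMeasure_moment hd1 hα (Nat.cast_nonneg _) (Nat.cast_nonneg _),
      ← ENNReal.ofReal_mul (div_nonneg (beta_pos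
        (add_pos_of_pos_of_nonneg hd1 (Nat.cast_nonneg _))
        (add_pos_of_pos_of_nonneg hα (Nat.cast_nonneg _))).le (beta_pos hd1 hα).le), stickMoment]

/-- One injection is kept from the likelihood sum; `c i` is the number of data points it sends to
atom `i`. -/
lemma exists_stickMoment_le_evidence {N : ℕ} {X : Type*} (x : Fin N → X) :
    ∃ (n : ℕ) (c : ℕ → ℕ), ∀ d α : ℝ, (d, α) ∈ pyParams →
      ENNReal.ofReal (stickMoment n c d α) ≤ evidence x d α := by
  classical
  obtain ⟨σ⟩ : Nonempty (Set.range x ↪ ℕ) := by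
    obtain ⟨f, hf⟩ := Countable.exists_injective_nat (Set.range x)
    exact ⟨⟨f, hf⟩⟩
  set g : Fin N → ℕ := fun j => σ ⟨x j, Set.mem_range_self j⟩ with hg
  refine ⟨Finset.univ.sup (fun j => g j + 1), fun i => (Finset.univ.filter fun j => g j = i).card,
    fun d α h => ?_⟩
  rw [← lintegral_prod_pyWeights _ _ h, evidence, pitmanYor]
  set n := Finset.univ.sup (fun j => g j + 1)
  set c : ℕ → ℕ := fun i => (Finset.univ.filter fun j => g j = i).card
  have hprod : ∀ w : ℕ → ℝ≥0∞, ∏ i ∈ Finset.range n, w i ^ c i = ∏ j, w (g j) := fun w => by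
    rw [← Finset.prod_fiberwise_of_maps_to (s := Finset.univ) (t := Finset.range n) (g := g)]
    · refine Finset.prod_congr rfl fun i _ => ?_
      rw [Finset.prod_congr rfl (g := fun _ => w i) fun j hj => by
        rw [(Finset.mem_filter.1 hj).2], Finset.prod_const]
    · exact fun j _ => Finset.mem_range.2
        (Finset.le_sup (f := fun j => g j + 1) (Finset.mem_univ j))
  calc ∫⁻ β, ∏ i ∈ Finset.range n, pyWeights β i ^ c i ∂(pySticks d α)
      = ∫⁻ β, ∏ j, ENNReal.ofReal (stickBreaking β (g j)) ∂(pySticks d α) :=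
        lintegral_congr fun β => hprod (pyWeights β)
    _ = ∫⁻ π, ∏ j, ENNReal.ofReal (π (g j)) ∂((pySticks d α).map stickBreaking) := by
        rw [lintegral_map (Finset.measurable_fun_prod _ fun j _ =>
          (measurable_pi_apply _).ennreal_ofReal) measurable_stickBreaking]
    _ ≤ _ := lintegral_mono fun π => ENNReal.le_tsum σ

lemma measurableSet_pyParams : MeasurableSet pyParams :=
  (measurableSet_le measurable_const measurable_fst).inter
    ((measurableSet_lt measurable_fst measurable_const).inter
      (measurableSet_lt measurable_fst.neg measurable_snd))

lemma marginal_pos {N : ℕ} {X : Type*} (x : Fin N → X) {P : Measure (ℝ × ℝ)}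
    (h0 : P ≠ 0) (hc : P pyParamsᶜ = 0) : 0 < marginal P x := by
  obtain ⟨n, c, hle⟩ := exists_stickMoment_le_evidence x
  have hae : ∀ᵐ p ∂P, p ∈ pyParams := hc
  have hmeas : AEMeasurable (fun p : ℝ × ℝ => ENNReal.ofReal (stickMoment n c p.1 p.2)) P := by
    rw [← Measure.restrict_eq_self_of_ae_mem hae]
    exact ((continuousOn_stickMoment n c).aemeasurable measurableSet_pyParams).ennreal_ofReal
  refine lt_of_lt_of_le ?_ (lintegral_mono_ae
    (g := fun p : ℝ × ℝ => evidence x p.1 p.2) (hae.mono fun p hp => hle p.1 p.2 hp))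
  rw [pos_iff_ne_zero, Ne, lintegral_eq_zero_iff' hmeas]
  intro hzero
  apply h0
  rw [← Measure.measure_univ_eq_zero]
  have hfalse : ∀ᵐ p ∂P, False := by
    filter_upwards [hzero, hae] with p hp hp'
    exact (ENNReal.ofReal_pos.2 (stickMoment_pos n c hp')).ne' hp
  rw [ae_iff] at hfalse
  simpa using hfalse

/-! ### Integrability against the prior -/

/-- A power of `α` with exponent less than `-1` is integrable with respect to every prior. -/
lemma lintegral_rpow_lt_top_of_isPYMPrior {P : Measure (ℝ × ℝ)} (hP : IsPYMPrior P) :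
    ∫⁻ p in pyParams, ENNReal.ofReal ((p.2 + 2) ^ (-(3 / 2) : ℝ)) ∂P < ∞ := by
  obtain ⟨ν, f, C, hν, hf, hfC, rfl⟩ := hP.proper_add_bounded
  have hα : ∀ p ∈ pyParams, -1 < p.2 := fun p hp => by linarith [hp.2.1, hp.2.2]
  rw [Measure.restrict_add, lintegral_add_measure]
  refine ENNReal.add_lt_top.2 ⟨?_, ?_⟩
  · calc ∫⁻ p in pyParams, ENNReal.ofReal ((p.2 + 2) ^ (-(3 / 2) : ℝ)) ∂ν
        ≤ ∫⁻ _ in pyParams, 1 ∂ν := by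
          refine setLIntegral_mono' measurableSet_pyParams fun p hp => ?_
          rw [← ENNReal.ofReal_one]
          exact ENNReal.ofReal_le_ofReal
            (Real.rpow_le_one_of_one_le_of_nonpos (by linarith [hα p hp]) (by norm_num))
      _ < ∞ := by simp
  · have hfin : ∫⁻ t : ℝ, ENNReal.ofReal ((1 + ‖t‖) ^ (-(3 / 2) : ℝ)) < ∞ :=
      finite_integral_one_add_norm (μ := volume) (by norm_num)
    have hle : volume.withDensity (fun p => (f p : ℝ≥0∞)) ≤
        (C : ℝ≥0∞) • (volume : Measure (ℝ × ℝ)) := by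
      rw [← withDensity_const]
      exact withDensity_mono (Filter.Eventually.of_forall fun p => ENNReal.coe_le_coe.2 (hfC p))
    calc ∫⁻ p in pyParams, ENNReal.ofReal ((p.2 + 2) ^ (-(3 / 2) : ℝ))
            ∂(volume.withDensity fun p => (f p : ℝ≥0∞))
        ≤ ∫⁻ p in pyParams, ENNReal.ofReal ((p.2 + 2) ^ (-(3 / 2) : ℝ))
            ∂((C : ℝ≥0∞) • (volume : Measure (ℝ × ℝ))) :=
          lintegral_mono' (Measure.restrict_mono le_rfl hle) le_rfl
      _ = C * ∫⁻ p in pyParams, ENNReal.ofReal ((p.2 + 2) ^ (-(3 / 2) : ℝ)) := by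
          rw [Measure.restrict_smul, lintegral_smul_measure, smul_eq_mul]
      _ ≤ C * ∫⁻ p in pyParams, ENNReal.ofReal (3 ^ (3 / 2 : ℝ)) *
            ENNReal.ofReal ((1 + ‖p.2‖) ^ (-(3 / 2) : ℝ)) := by
          refine mul_le_mul_right ?_ _
          refine setLIntegral_mono' measurableSet_pyParams fun p hp => ?_
          rw [← ENNReal.ofReal_mul (by positivity)]
          refine ENNReal.ofReal_le_ofReal ?_
          have h1 := hα p hp
          -- The constant `3` suffices down to `α = -5/4`, beyond the admissible `α > -1`.
          have h3 : (1 + ‖p.2‖) / 3 ≤ p.2 + 2 := by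
            rw [Real.norm_eq_abs]
            rcases abs_cases p.2 with h | h <;> linarith
          calc (p.2 + 2) ^ (-(3 / 2) : ℝ) ≤ ((1 + ‖p.2‖) / 3) ^ (-(3 / 2) : ℝ) :=
                Real.rpow_le_rpow_of_nonpos (by positivity) h3 (by norm_num)
            _ = 3 ^ (3 / 2 : ℝ) * (1 + ‖p.2‖) ^ (-(3 / 2) : ℝ) := by
                rw [Real.div_rpow (by positivity) (by norm_num),
                  Real.rpow_neg (x := 3) (by norm_num),
                  div_inv_eq_mul, mul_comm]
      _ ≤ C * ∫⁻ p in Set.Icc (0 : ℝ) 1 ×ˢ Set.univ, ENNReal.ofReal (3 ^ (3 / 2 : ℝ)) *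
            ENNReal.ofReal ((1 + ‖p.2‖) ^ (-(3 / 2) : ℝ)) := by
          refine mul_le_mul_right ?_ _
          -- The parameters lie in a strip of unit width in `d`, so only the one-dimensional
          -- integral in `α` matters.
          exact lintegral_mono_set fun p hp => ⟨⟨hp.1, hp.2.1.le⟩, trivial⟩
      _ = C * (ENNReal.ofReal (3 ^ (3 / 2 : ℝ)) *
            ∫⁻ t : ℝ, ENNReal.ofReal ((1 + ‖t‖) ^ (-(3 / 2) : ℝ))) := by
          have hm : Measurable fun p : ℝ × ℝ => ENNReal.ofReal ((1 + ‖p.2‖) ^ (-(3 / 2) : ℝ)) :=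
            ((measurable_snd.norm.const_add 1).pow_const _).ennreal_ofReal
          rw [lintegral_const_mul _ hm, Measure.volume_eq_prod, ← Measure.prod_restrict,
            Measure.restrict_univ, lintegral_prod _ hm.aemeasurable]
          simp
      _ < ∞ := ENNReal.mul_lt_top ENNReal.coe_lt_top (ENNReal.mul_lt_top ENNReal.ofReal_lt_top hfin)

end

/-! ### Conclusion -/

theorem mainTheorem3 {N : ℕ} {X : Type*} (x : Fin N → X) (hx : numDistinct x + 2 ≤ N)
    (P : Measure (ℝ × ℝ)) (hP : IsPYMPrior P) :
    0 < marginal P x ∧ marginal P x < ∞ ∧ pymEstimate P x < ∞ := by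
  obtain ⟨C, hC, hbound⟩ := exists_evidence_entropy_bound x hx
  have hae : ∀ᵐ p ∂P, p ∈ pyParams := hP.carried
  have hpos := marginal_pos x hP.ne_zero hP.carried
  have hfin : ∫⁻ p, ENNReal.ofReal (C * (p.2 + 2) ^ (-(3 / 2) : ℝ)) ∂P < ∞ := by
    have h := lintegral_rpow_lt_top_of_isPYMPrior hP
    rw [Measure.restrict_eq_self_of_ae_mem hae] at h
    simp_rw [ENNReal.ofReal_mul hC]
    rw [lintegral_const_mul _ (by fun_prop)]
    exact ENNReal.mul_lt_top ENNReal.ofReal_lt_top h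
  refine ⟨hpos, lt_of_le_of_lt (lintegral_mono_ae ?_) hfin, ?_⟩
  · exact hae.mono fun p hp => (hbound p.1 p.2 hp).1
  · have hle : pymEstimate P x ≤
        ∫⁻ p, ENNReal.ofReal (C * (p.2 + 2) ^ (-(3 / 2) : ℝ)) * (marginal P x)⁻¹ ∂P := by
      refine lintegral_mono_ae (hae.mono fun p hp => ?_)
      rw [div_eq_mul_inv (evidence x p.1 p.2), ← mul_assoc]
      gcongr
      rw [mul_comm]
      -- In `[0, ∞]` the inequality `e * (m / e) ≤ m` holds even for `e = 0` or `e = ∞`, so the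
      -- evidence cancels without case distinctions.
      exact ENNReal.mul_div_le.trans (hbound p.1 p.2 hp).2
    refine hle.trans_lt ?_
    rw [lintegral_mul_const _ (by fun_prop)]
    exact ENNReal.mul_lt_top hfin (ENNReal.inv_lt_top.2 hpos)
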